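/- Let \(m,n\ge 1\) and \(k,l\) be integers with \(\gcd(n,k)=1\), \(k^m\equiv 1 \pmod n\) and \(l(k-1)\equiv 0\pmod n\), and let \[G=M(k,l,m,n)=\langle x,y \mid y^m=x^l,\ x^n=1,\ y^{-1}xy=x^k\rangle .\] **Balanced covers.** Let \(\widetilde\Gamma\) be the set of irreducible complex characters of \(G\), and let \(\langle\theta|\varphi\rangle=\frac1{|G|}\sum_{g\in G}\theta(g)\overline{\varphi(g)}\). A finite quasigroup \(Q\) (a set with a multiplication for which all equations \(ax=b\) and \(ya=b\) are uniquely solvable) is a *balanced cover* of \(G\) if there is a surjection \(f:Q\to\widetilde\Gamma\) such that - \(|f^{-1}\{\theta\}|=\theta(1)^2\) for all \(\theta\in\widetilde\Gamma\); - \(|\{(p,q)\in f^{-1}\{\theta\}\times f^{-1}\{\varphi\}: f(pq)=\psi\}|=\theta(1)\varphi(1)\psi(1)\langle\theta\varphi|\psi\rangle\) for all \(\theta,\varphi,\psi\in\widetilde\Gamma\); - for all \(\theta,\varphi,\psi\in\widetilde\Gamma\), the number of pairs \((p,p')\in f^{-1}\{\theta\}\times f^{-1}\{\varphi\}\) with \(pp'=q\)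 is the same for all \(q\in f^{-1}\{\psi\}\). **Notation.** The cyclic group \(K\) of order \(m\) acts on \(\mathbb Z/n\), its generator acting as multiplication by \(k\). For \(a\in\mathbb Z/n\) let \(Ka\) be the orbit of \(a\), \(r_a=|Ka|\), and let \(s_a\) be the order of the stabilizer of \(a\) in \(K\). Let \(I\) be a set of representatives of the orbits, one for each orbit. For \(a,b,c\in\mathbb Z/n\) put \(S(a,b,c)=|\{(r,s)\in Ka\times Kb: r+s=c\}|\). Write \(\{t\}\) for the fractional part of \(t\); \(\{al/n\}\) is well defined for \(a\in\mathbb Z/n\). For \(a,b,c\in\mathbb Z/n\) and integers \(0\le\alpha<s_a\), \(0\le\beta<s_b\), let \(\Gamma^{c}_{a,\alpha;b,\beta}\) be the set of integers \(0\le\gamma<s_c\) with \[\alpha+\beta-\gamma\equiv\{al/n\}+\{bl/n\}-\{cl/n\}\pmod{\gcd(s_a,s_b)},\] that is, such that the difference of the two sides is an integer multiple of \(\gcd(s_a,s_b)\). A finite subset \(S\) of \(Q\) is identified with the formal sum \(\sum_{q\in S}q\) in \(\mathbb NQ\subset\mathbb QQ\), and products of such sums are formed by bilinear extension of the multiplication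 of \(Q\). **Statement.** Let \(Q\) be a quasigroup of order \(mn\). 1. \(Q\) is a balanced cover of \(G\) if and only if there are pairwise disjoint subsets \(S_{a,\alpha}\subseteq Q\) (\(a\in I\), \(0\le\alpha<s_a\)) with \(|S_{a,\alpha}|=r_a^2\) such that for all \(a,b\in I\), \(0\le\alpha<s_a\), \(0\le\beta<s_b\), \[S_{a,\alpha}\cdot S_{b,\beta}=\gcd(r_a,r_b)\sum_{c\in I}\ \sum_{\gamma\in\Gamma^{c}_{a,\alpha;b,\beta}}S(a,b,c)\,S_{c,\gamma}.\] 2. \(Q\) is a balanced cover of \(G\) if and only if there are pairwise disjoint subsets \(S_{a,\alpha}\subseteq Q\) (\(a\in I\), \(0\le\alpha<s_a\)) with \(|S_{a,\alpha}|=r_a^2\) such that, with the convention \(S_{ak^i,\alpha}=S_{a,\alpha}\) for all \(i\ge0\), for all \(a,b\in I\), \(0\le\alpha<s_a\), \(0\le\beta<s_b\), \[S_{a,\alpha}\cdot S_{b,\beta}=r_a\gcd(r_a,r_b)\sum_{i=0}^{r_b-1}\ \sum_{\gamma\in\Gamma^{a+bk^i}_{a,\alpha;b,\beta}}\frac{S_{a+bk^i,\gamma}}{r_{a+bk^i}}.\]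 -/

import Mathlib

/-- A quasigroup: both equations `a * x = b` and `y * a = b` are uniquely solvable. -/
def IsQuasigroup (Q : Type*) [Mul Q] : Prop :=
  (∀ a b : Q, ∃! x : Q, a * x = b) ∧ (∀ a b : Q, ∃! y : Q, y * a = b)

/-- The multiplicity `m_q(S, T)` of `q` in the product `S ⬝ T`. -/
noncomputable def mulMultiplicity {Q : Type*} [Mul Q] (S T : Set Q) (q : Q) : ℕ :=
  {p : Q × Q | p.1 ∈ S ∧ p.2 ∈ T ∧ p.1 * p.2 = q}.ncard

/-- `f : Q → X` covers the weight function `w` and the multiplication function `α` on `X`.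
Weights and multiplication coefficients are written as complex numbers, because those that
come from characters are given by complex formulas. -/
structure IsCovering {Q X : Type*} [Mul Q] (w : X → ℂ) (α : X → X → X → ℂ) (f : Q → X) :
    Prop where
  surjective : Function.Surjective f
  weight : ∀ x : X, w x = ((f ⁻¹' {x}).ncard : ℂ)
  mult : ∀ x y z : X,
    α x y z = ({p : Q × Q | f p.1 = x ∧ f p.2 = y ∧ f (p.1 * p.2) = z}.ncard : ℂ)

/-- With `S_x = f ⁻¹' {x}`, the number `m_q(S_x, S_y)` depends only on `x`, `y` and the
fibre `S_z` that contains `q`. -/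
def IsBalanced {Q X : Type*} [Mul Q] (f : Q → X) : Prop :=
  ∀ (x y z : X), ∀ q ∈ f ⁻¹' {z}, ∀ q' ∈ f ⁻¹' {z},
    mulMultiplicity (f ⁻¹' {x}) (f ⁻¹' {y}) q = mulMultiplicity (f ⁻¹' {x}) (f ⁻¹' {y}) q'

/-- The set of irreducible complex characters of a group. -/
def irrChar (G : Type*) [Group G] : Set (G → ℂ) :=
  {θ | ∃ (d : ℕ) (ρ : Representation ℂ G (Fin d → ℂ)), ρ.IsIrreducible ∧ ρ.character = θ}

/-- The scalar product `⟨θ | φ⟩ = (1 / |G|) ∑_g θ(g) conj(φ(g))` for a finite group `G`. -/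
noncomputable def charInner {G : Type*} (θ φ : G → ℂ) : ℂ :=
  (Nat.card G : ℂ)⁻¹ * ∑ᶠ g : G, θ g * (starRingEnd ℂ) (φ g)

/-- The weight `θ ↦ θ(1)²` of the weighted character quasigroup. -/
def charWeight (G : Type*) [Group G] (θ : irrChar G) : ℂ := θ.1 1 ^ 2

/-- The multiplication function `θ(1) φ(1) ψ(1) ⟨θ φ | ψ⟩` of the weighted character
quasigroup. -/
noncomputable def charMult (G : Type*) [Group G] (θ φ ψ : irrChar G) : ℂ :=
  θ.1 1 * φ.1 1 * ψ.1 1 * charInner (θ.1 * φ.1) ψ.1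

/-- `Q` is a balanced cover of `G`, i.e. of the weighted character quasigroup of `G`. -/
def IsBalancedCover (G Q : Type*) [Group G] [Mul Q] : Prop :=
  ∃ f : Q → irrChar G, IsCovering (charWeight G) (charMult G) f ∧ IsBalanced f

/-- The relators of `⟨x, y | y^m = x^l, x^n = 1, y⁻¹ x y = x^k⟩`, where `x` is generator `0`
and `y` is generator `1`. -/
def metacyclicRels (k l : ℤ) (m n : ℕ) : Set (FreeGroup (Fin 2)) :=
  let x : FreeGroup (Fin 2) := FreeGroup.of 0
  let y : FreeGroup (Fin 2) := FreeGroup.of 1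
  {y ^ m * (x ^ l)⁻¹, x ^ n, y⁻¹ * x * y * (x ^ k)⁻¹}

/-- The metacyclic group `M(k, l, m, n)`. -/
abbrev MetacyclicGroup (k l : ℤ) (m n : ℕ) : Type := PresentedGroup (metacyclicRels k l m n)

open Classical in
/-- The orbit `K a = {a k^i}` of `a` in `ℤ/n`. -/
noncomputable def orbitFinset {n : ℕ} [NeZero n] (k : ℤ) (a : ZMod n) : Finset (ZMod n) :=
  Finset.univ.filter fun b => ∃ i : ℕ, b = a * (k : ZMod n) ^ i

/-- `r_a`, the size of the orbit of `a`. -/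
noncomputable def orbitSize {n : ℕ} [NeZero n] (k : ℤ) (a : ZMod n) : ℕ :=
  (orbitFinset k a).card

/-- `s_a`, the size of the stabilizer of `a` in the cyclic group of order `m` whose elements
`j = 0, …, m - 1` act on `ℤ/n` as multiplication by `k^j` (where `k^m = 1` in `ℤ/n`). -/
def stabSize {n : ℕ} (k : ℤ) (m : ℕ) (a : ZMod n) : ℕ :=
  ((Finset.range m).filter fun j => a * (k : ZMod n) ^ j = a).card

/-- `I` contains exactly one element of each orbit. -/
def IsOrbitRepresentatives {n : ℕ} [NeZero n] (k : ℤ) (I : Finset (ZMod n)) : Prop :=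
  ∀ b : ZMod n, ∃! a : ZMod n, a ∈ I ∧ a ∈ orbitFinset k b

open Classical in
/-- `S(a, b, c)`, the number of `(r, s) ∈ K a × K b` with `r + s = c` in `ℤ/n`. -/
noncomputable def orbitSumCount {n : ℕ} [NeZero n] (k : ℤ) (a b c : ZMod n) : ℕ :=
  ((orbitFinset k a ×ˢ orbitFinset k b).filter fun p => p.1 + p.2 = c).card

/-- The fractional part `{a l / n}`; it does not depend on the integer that represents `a`. -/
def fracPart {n : ℕ} (l : ℤ) (a : ZMod n) : ℚ := Int.fract ((a.val : ℚ) * l / n)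

/-- `α + β - γ ≡ {al/n} + {bl/n} - {cl/n} mod gcd(s_a, s_b)`: the two sides, which are
rational numbers, differ by an integer multiple of the modulus. -/
def GammaCond {n : ℕ} (k l : ℤ) (m : ℕ) (a b c : ZMod n) (α β γ : ℕ) : Prop :=
  ∃ t : ℤ, ((α : ℚ) + β - γ) - (fracPart l a + fracPart l b - fracPart l c)
    = t * (Nat.gcd (stabSize k m a) (stabSize k m b) : ℚ)

open Classical in
/-- The indices `0 ≤ γ < s_c` that satisfy the congruence. -/
noncomputable def gammaSet {n : ℕ} (k l : ℤ) (m : ℕ) (a b c : ZMod n) (α β : ℕ) : Finset ℕ :=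
  (Finset.range (stabSize k m c)).filter fun γ => GammaCond k l m a b c α β γ

/-- The element `∑_{q ∈ S} q` of the semialgebra `R Q`. -/
noncomputable def setSum (R : Type*) [Semiring R] {Q : Type*} (S : Finset Q) :
    MonoidAlgebra R Q :=
  ∑ q ∈ S, MonoidAlgebra.single q 1

/-- The sets `S_{a,α}` (`a ∈ I`, `0 ≤ α < s_a`) are pairwise disjoint and `|S_{a,α}| = r_a²`.
Values of `S` at other indices are irrelevant. -/
def IsDisjointFamily {n : ℕ} [NeZero n] (k : ℤ) (m : ℕ) (I : Finset (ZMod n)) {Q : Type*}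
    (S : ZMod n → ℕ → Finset Q) : Prop :=
  (∀ a ∈ I, ∀ α < stabSize k m a, (S a α).card = orbitSize k a ^ 2) ∧
  (∀ a ∈ I, ∀ α < stabSize k m a, ∀ b ∈ I, ∀ β < stabSize k m b,
    (a, α) ≠ (b, β) → Disjoint (S a α) (S b β))

/-! ### Orbits of multiplication by `k` on `ℤ/n`, and fractional parts -/

section Orbits

variable {n m : ℕ} [NeZero n] [NeZero m] {k l : ℤ}

/-! Let `ζ = exp(2πi/n)`. Each pair `(a, α)` with `a ∈ I`, `0 ≤ α < s_a` gives a monomial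
representation of degree `r_a`: `x` is diagonal with eigenvalues `ζ^(-b)`, `b ∈ Ka`, and `y`
permutes the basis up to the scalar `exp(2πi(α - {al/n})/m)`, whose `m`-th power is `ζ^(-al)`, as
`y^m = x^l` demands. It is irreducible because the eigenvalues of `x` are distinct and `y` permutes
them transitively. The sum of all `r_a χ_{a,α}` takes the value `mn` at `y^0 x^0` and `0` at the
other words `y^j x^i` with `j < m` and `i` taken mod `n`. Hence these words are distinct, `|G| =
mn`, and orthogonality leaves no room for further irreducible characters.

The core is `charInner_metacyclicChar`. In `⟨χ_{a,α} χ_{b,β} | χ_{c,γ}⟩` the sum over `i` counts the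
solutions of `r + s = t` in the three orbits, which gives `r_c S(a,b,c)`. The sum over `j` is a
geometric series over the multiples of `lcm(r_a, r_b)` below `m`; it has `gcd(s_a, s_b)` terms, and
it vanishes unless `γ` satisfies the congruence defining `Γ`. Since `lcm(r_a, r_b) gcd(s_a, s_b) =
m`, the prescribed number of pairs becomes `r_c²` times `gcd(r_a, r_b) S(a,b,c)`, or `0`.

A fibre over `χ_{c,γ}` has `r_c²` elements, so balance says that each of them has multiplicity
`gcd(r_a, r_b) S(a,b,c)`, or `0`, in the product of two fibres (`isCovering_and_isBalanced_iff`).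
Conversely, disjoint sets of sizes `r_a²` fill `Q`, because `∑ s_a r_a² = m ∑ r_a = mn`. The first
criterion compares coefficients in the formal products; the second follows in the same way from `r_a
· #{i < r_b : a + b k^i ∈ Kc} = r_c S(a,b,c)`. -/

theorem mem_orbitFinset {a b : ZMod n} :
    b ∈ orbitFinset k a ↔ ∃ i : ℕ, b = a * (k : ZMod n) ^ i := by
  simp [orbitFinset]

theorem self_mem_orbitFinset (a : ZMod n) : a ∈ orbitFinset k a :=
  mem_orbitFinset.2 ⟨0, by simp⟩

theorem mul_pow_mem_orbitFinset {a b : ZMod n} (hb : b ∈ orbitFinset k a) (i : ℕ) :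
    b * (k : ZMod n) ^ i ∈ orbitFinset k a := by
  obtain ⟨j, rfl⟩ := mem_orbitFinset.1 hb
  exact mem_orbitFinset.2 ⟨j + i, by rw [pow_add, mul_assoc]⟩

/-- Orbits use natural exponents only, so `k^((m-1)i)` serves as the inverse of `k^i`. -/
theorem pow_mul_eq_one {R : Type*} [Monoid R] {x : R} (hx : x ^ m = 1) (i : ℕ) :
    x ^ i * x ^ ((m - 1) * i) = 1 := by
  have : 1 ≤ m := NeZero.one_le
  rw [← pow_add, show i + (m - 1) * i = m * i by
    conv_lhs => rw [← one_mul i, ← mul_assoc, mul_one, ← add_mul, Nat.add_sub_cancel' this],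
    pow_mul, hx, one_pow]

theorem mem_orbitFinset_symm (hk : (k : ZMod n) ^ m = 1) {a b : ZMod n}
    (h : b ∈ orbitFinset k a) : a ∈ orbitFinset k b := by
  obtain ⟨i, rfl⟩ := mem_orbitFinset.1 h
  exact mem_orbitFinset.2 ⟨(m - 1) * i, by rw [mul_assoc, pow_mul_eq_one hk, mul_one]⟩

theorem orbitFinset_eq_of_mem (hk : (k : ZMod n) ^ m = 1) {a b : ZMod n}
    (h : b ∈ orbitFinset k a) : orbitFinset k b = orbitFinset k a := by
  ext c
  constructor <;> intro hc
  · obtain ⟨i, rfl⟩ := mem_orbitFinset.1 hc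
    exact mul_pow_mem_orbitFinset h i
  · obtain ⟨i, rfl⟩ := mem_orbitFinset.1 hc
    exact mul_pow_mem_orbitFinset (mem_orbitFinset_symm hk h) i

theorem orbitSize_eq_of_mem (hk : (k : ZMod n) ^ m = 1) {a b : ZMod n}
    (h : b ∈ orbitFinset k a) : orbitSize k b = orbitSize k a := by
  rw [orbitSize, orbitFinset_eq_of_mem hk h, orbitSize]

theorem orbitSize_pos (a : ZMod n) : 0 < orbitSize k a :=
  Finset.card_pos.2 ⟨a, self_mem_orbitFinset a⟩

omit [NeZero n] in
theorem iterate_mul_right_eq (a : ZMod n) (i : ℕ) :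
    (fun b : ZMod n => b * (k : ZMod n))^[i] a = a * (k : ZMod n) ^ i := by
  induction i with
  | zero => simp
  | succ i ih => rw [Function.iterate_succ_apply', ih, pow_succ, mul_assoc]

omit [NeZero n] [NeZero m] in
theorem isPeriodicPt_mul_right (hk : (k : ZMod n) ^ m = 1) (a : ZMod n) :
    Function.IsPeriodicPt (fun b : ZMod n => b * (k : ZMod n)) m a := by
  rw [Function.IsPeriodicPt, Function.IsFixedPt, iterate_mul_right_eq, hk, mul_one]

theorem orbitFinset_eq_image (hk : (k : ZMod n) ^ m = 1) (a : ZMod n) :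
    orbitFinset k a = (Finset.range
      (Function.minimalPeriod (fun b : ZMod n => b * (k : ZMod n)) a)).image
        fun i => a * (k : ZMod n) ^ i := by
  have hpos := (isPeriodicPt_mul_right hk a).minimalPeriod_pos (NeZero.pos m)
  ext b
  rw [mem_orbitFinset, Finset.mem_image]
  constructor
  · rintro ⟨i, rfl⟩
    refine ⟨_, Finset.mem_range.2 (Nat.mod_lt i hpos), ?_⟩
    rw [← iterate_mul_right_eq, ← iterate_mul_right_eq, Function.iterate_mod_minimalPeriod_eq]
  · rintro ⟨i, -, rfl⟩
    exact ⟨i, rfl⟩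

omit [NeZero n] in
theorem injOn_mul_pow_minimalPeriod (a : ZMod n) :
    Set.InjOn (fun i : ℕ => a * (k : ZMod n) ^ i) (Finset.range
      (Function.minimalPeriod (fun b : ZMod n => b * (k : ZMod n)) a)) := by
  have := Function.iterate_injOn_Iio_minimalPeriod
    (f := fun b : ZMod n => b * (k : ZMod n)) (x := a)
  simpa [iterate_mul_right_eq, Set.Iio_def] using this

theorem orbitSize_eq_minimalPeriod (hk : (k : ZMod n) ^ m = 1) (a : ZMod n) :
    orbitSize k a = Function.minimalPeriod (fun b : ZMod n => b * (k : ZMod n)) a := by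
  rw [orbitSize, orbitFinset_eq_image hk,
    Finset.card_image_of_injOn (injOn_mul_pow_minimalPeriod a), Finset.card_range]

theorem sum_orbitFinset (hk : (k : ZMod n) ^ m = 1) (a : ZMod n) {R : Type*} [AddCommMonoid R]
    (F : ZMod n → R) :
    ∑ b ∈ orbitFinset k a, F b = ∑ i ∈ Finset.range (orbitSize k a), F (a * (k : ZMod n) ^ i) := by
  rw [orbitFinset_eq_image hk, Finset.sum_image (injOn_mul_pow_minimalPeriod a),
    orbitSize_eq_minimalPeriod hk]

/-- The orbit size is the minimal period of multiplication by `k` at `a`. This turns every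
stabilizer condition into a divisibility. -/
theorem mul_pow_eq_self_iff (hk : (k : ZMod n) ^ m = 1) (a : ZMod n) (j : ℕ) :
    a * (k : ZMod n) ^ j = a ↔ orbitSize k a ∣ j := by
  rw [orbitSize_eq_minimalPeriod hk, ← Function.isPeriodicPt_iff_minimalPeriod_dvd,
    Function.IsPeriodicPt, Function.IsFixedPt, iterate_mul_right_eq]

theorem sum_range_filter_dvd {R : Type*} [AddCommMonoid R] (d g : ℕ) (hd : 0 < d) (F : ℕ → R) :
    ∑ j ∈ (Finset.range (d * g)).filter (d ∣ ·), F j = ∑ t ∈ Finset.range g, F (d * t) := by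
  rw [← Finset.sum_image (f := F) (g := fun t => d * t) (s := Finset.range g)
    (fun x _ y _ h => Nat.eq_of_mul_eq_mul_left hd h)]
  refine Finset.sum_congr ?_ fun _ _ => rfl
  ext j
  simp only [Finset.mem_filter, Finset.mem_range, Finset.mem_image]
  constructor
  · rintro ⟨h, t, rfl⟩
    exact ⟨t, lt_of_mul_lt_mul_left h (Nat.zero_le d), rfl⟩
  · rintro ⟨t, ht, rfl⟩
    exact ⟨Nat.mul_lt_mul_of_pos_left ht hd, t, rfl⟩

theorem orbitSize_mul_stabSize (hk : (k : ZMod n) ^ m = 1) (a : ZMod n) :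
    orbitSize k a * stabSize k m a = m := by
  obtain ⟨g, hg⟩ : orbitSize k a ∣ m := by rw [← mul_pow_eq_self_iff hk, hk, mul_one]
  have : stabSize k m a = g := by
    rw [stabSize, Finset.card_eq_sum_ones]
    simp_rw [mul_pow_eq_self_iff hk]
    conv_lhs => rw [hg]
    rw [sum_range_filter_dvd _ _ (orbitSize_pos a)]
    simp
  rw [this, ← hg]

theorem stabSize_pos (hk : (k : ZMod n) ^ m = 1) (a : ZMod n) : 0 < stabSize k m a :=
  Nat.pos_of_mul_pos_left (orbitSize_mul_stabSize hk a ▸ NeZero.pos m)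

theorem stabSize_eq_of_mem (hk : (k : ZMod n) ^ m = 1) {a b : ZMod n}
    (h : b ∈ orbitFinset k a) : stabSize k m b = stabSize k m a := by
  have h2 := orbitSize_mul_stabSize hk b
  rw [orbitSize_eq_of_mem hk h] at h2
  exact Nat.eq_of_mul_eq_mul_left (orbitSize_pos a) (h2.trans (orbitSize_mul_stabSize hk a).symm)

theorem orbitFinset_zero : orbitFinset k (0 : ZMod n) = {0} := by
  ext b; simp [mem_orbitFinset]

omit [NeZero n] [NeZero m] in
theorem stabSize_zero : stabSize k m (0 : ZMod n) = m := by
  simp [stabSize]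

/-- With `s = ug`, `s' = vg` and `u`, `v` coprime, `ru = r'v` forces `r = vw`, `r' = uw`, so the lcm
is `uvw`. Applied to orbit and stabilizer sizes, where both products are `m`. -/
theorem Nat.lcm_mul_gcd_of_mul_eq {r s r' s' : ℕ} (hs : 0 < s) (h : r * s = r' * s') :
    r.lcm r' * s.gcd s' = r * s := by
  obtain ⟨g, u, v, hg, hc, hu, hv⟩ := Nat.exists_coprime' (m := s) (n := s')
    (Nat.gcd_pos_of_pos_left _ hs)
  subst hu hv
  have h1 : r * u = r' * v := by
    apply Nat.eq_of_mul_eq_mul_right hg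
    rw [mul_assoc, mul_assoc, h]
  obtain ⟨w, rfl⟩ : u ∣ r' := hc.dvd_of_dvd_mul_right ⟨r, by rw [← h1, mul_comm]⟩
  have hu0 : 0 < u := Nat.pos_of_mul_pos_right hs
  have h2 : r = v * w := by
    apply Nat.eq_of_mul_eq_mul_right hu0
    rw [h1]; ring
  subst h2
  rw [Nat.lcm_mul_right, Nat.gcd_mul_right, hc.gcd_eq_one, hc.symm.lcm_eq_mul]
  ring

theorem eq_of_mem_of_mem_orbitFinset {I : Finset (ZMod n)} (hI : IsOrbitRepresentatives k I)
    {a b c : ZMod n} (ha : a ∈ I) (hb : b ∈ I) (hac : a ∈ orbitFinset k c)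
    (hbc : b ∈ orbitFinset k c) : a = b :=
  (hI c).unique ⟨ha, hac⟩ ⟨hb, hbc⟩

theorem eq_of_mem_orbitFinset {I : Finset (ZMod n)} (hI : IsOrbitRepresentatives k I)
    {a b : ZMod n} (ha : a ∈ I) (hb : b ∈ I) (h : a ∈ orbitFinset k b) : a = b :=
  eq_of_mem_of_mem_orbitFinset hI ha hb h (self_mem_orbitFinset b)

theorem sum_sum_orbitFinset (hk : (k : ZMod n) ^ m = 1) {I : Finset (ZMod n)}
    (hI : IsOrbitRepresentatives k I) {R : Type*} [AddCommMonoid R] (F : ZMod n → R) :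
    ∑ a ∈ I, ∑ b ∈ orbitFinset k a, F b = ∑ b, F b := by
  classical
  rw [← Finset.sum_biUnion]
  · refine Finset.sum_congr ?_ fun _ _ => rfl
    ext b
    simp only [Finset.mem_biUnion, Finset.mem_univ, iff_true]
    obtain ⟨a, ⟨ha, hab⟩, -⟩ := hI b
    exact ⟨a, ha, mem_orbitFinset_symm hk hab⟩
  · intro a ha b hb hab
    refine Finset.disjoint_left.2 fun c hca hcb => hab ?_
    exact eq_of_mem_of_mem_orbitFinset hI ha hb (mem_orbitFinset_symm hk hca)
      (mem_orbitFinset_symm hk hcb)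

theorem orbitSumCount_mul_pow (hk : (k : ZMod n) ^ m = 1) (a b c : ZMod n) (i : ℕ) :
    orbitSumCount k a b (c * (k : ZMod n) ^ i) = orbitSumCount k a b c := by
  classical
  have hcancel : ∀ x : ZMod n, x * (k : ZMod n) ^ i * (k : ZMod n) ^ ((m - 1) * i) = x := by
    intro x; rw [mul_assoc, pow_mul_eq_one hk, mul_one]
  have hcancel' : ∀ x : ZMod n, x * (k : ZMod n) ^ ((m - 1) * i) * (k : ZMod n) ^ i = x := by
    intro x; rw [mul_assoc, mul_comm (_ ^ _), pow_mul_eq_one hk, mul_one]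
  symm
  unfold orbitSumCount
  refine Finset.card_bij' (fun p _ => (p.1 * (k : ZMod n) ^ i, p.2 * (k : ZMod n) ^ i))
    (fun p _ => (p.1 * (k : ZMod n) ^ ((m - 1) * i), p.2 * (k : ZMod n) ^ ((m - 1) * i)))
    ?_ ?_ ?_ ?_
  · simp only [Finset.mem_filter, Finset.mem_product]
    rintro p ⟨⟨h1, h2⟩, rfl⟩
    exact ⟨⟨mul_pow_mem_orbitFinset h1 _, mul_pow_mem_orbitFinset h2 _⟩, by ring⟩
  · simp only [Finset.mem_filter, Finset.mem_product]
    rintro p ⟨⟨h1, h2⟩, h3⟩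
    exact ⟨⟨mul_pow_mem_orbitFinset h1 _, mul_pow_mem_orbitFinset h2 _⟩, by
      rw [← add_mul, h3, hcancel]⟩
  · intro p _; simp only [hcancel]
  · intro p _; simp only [hcancel']

theorem orbitSumCount_eq_of_mem (hk : (k : ZMod n) ^ m = 1) (a b : ZMod n) {c c' : ZMod n}
    (h : c' ∈ orbitFinset k c) : orbitSumCount k a b c' = orbitSumCount k a b c := by
  obtain ⟨i, rfl⟩ := mem_orbitFinset.1 h
  exact orbitSumCount_mul_pow hk a b c i

open Classical in
theorem sum_orbits_ite_add_eq (hk : (k : ZMod n) ^ m = 1) (a b c : ZMod n) :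
    ∑ r ∈ orbitFinset k a, ∑ s ∈ orbitFinset k b, ∑ t ∈ orbitFinset k c,
      (if r + s = t then 1 else 0) = orbitSize k c * orbitSumCount k a b c := by
  have : ∀ t ∈ orbitFinset k c,
      ∑ r ∈ orbitFinset k a, ∑ s ∈ orbitFinset k b, (if r + s = t then 1 else 0)
        = orbitSumCount k a b c := by
    intro t ht
    rw [← orbitSumCount_eq_of_mem hk a b ht, orbitSumCount, Finset.card_filter,
      Finset.sum_product]
  rw [orbitSize, ← smul_eq_mul, ← Finset.sum_const, ← Finset.sum_congr rfl this]
  simp_rw [Finset.sum_comm (s := orbitFinset k b) (t := orbitFinset k c)]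
  rw [Finset.sum_comm]

-- Both sides count the `(r, s) ∈ Ka × Kb` with `r + s ∈ Kc`. Multiplying by a power of `k` moves
-- `r` to `a`, so each `r` contributes equally. This links the two forms of the product formula.
open Classical in
theorem orbitSize_mul_sum_range_ite (hk : (k : ZMod n) ^ m = 1) (a b c : ZMod n) :
    orbitSize k a * ∑ i ∈ Finset.range (orbitSize k b),
      (if a + b * (k : ZMod n) ^ i ∈ orbitFinset k c then 1 else 0)
        = orbitSize k c * orbitSumCount k a b c := by
  rw [← sum_orbits_ite_add_eq hk]
  have hr : ∀ r ∈ orbitFinset k a, ∑ s ∈ orbitFinset k b, ∑ t ∈ orbitFinset k c,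
      (if r + s = t then 1 else 0) = ∑ i ∈ Finset.range (orbitSize k b),
      (if a + b * (k : ZMod n) ^ i ∈ orbitFinset k c then 1 else 0) := by
    intro r hr
    rw [← sum_orbitFinset hk b fun x => if a + x ∈ orbitFinset k c then 1 else 0]
    simp_rw [Finset.sum_ite_eq]
    obtain ⟨i, rfl⟩ := mem_orbitFinset.1 hr
    symm
    refine Finset.sum_bij' (fun s _ => s * (k : ZMod n) ^ i)
      (fun s _ => s * (k : ZMod n) ^ ((m - 1) * i)) (fun s hs => mul_pow_mem_orbitFinset hs _)
      (fun s hs => mul_pow_mem_orbitFinset hs _) ?_ ?_ ?_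
    · intro s _; rw [mul_assoc, pow_mul_eq_one hk, mul_one]
    · intro s _; rw [mul_assoc, mul_comm (_ ^ _), pow_mul_eq_one hk, mul_one]
    · intro s _
      rw [← add_mul]
      refine if_congr ⟨fun h => mul_pow_mem_orbitFinset h _, fun h => ?_⟩ rfl rfl
      have := mul_pow_mem_orbitFinset h ((m - 1) * i)
      rwa [mul_assoc, pow_mul_eq_one hk, mul_one] at this
  rw [Finset.sum_congr rfl hr, Finset.sum_const, smul_eq_mul, orbitSize]

theorem exists_mem_of_orbitSumCount_ne_zero {a b c : ZMod n} (h : orbitSumCount k a b c ≠ 0) :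
    ∃ r ∈ orbitFinset k a, ∃ s ∈ orbitFinset k b, r + s = c := by
  classical
  obtain ⟨⟨r, s⟩, hp⟩ := Finset.card_ne_zero.1 h
  simp only [Finset.mem_filter, Finset.mem_product] at hp
  exact ⟨r, hp.1.1, s, hp.1.2, hp.2⟩

theorem Int.fract_intCast_div_eq {x y : ℤ} (h : (x : ZMod n) = y) :
    Int.fract ((x : ℚ) / n) = Int.fract ((y : ℚ) / n) := by
  have hn : (n : ℚ) ≠ 0 := NeZero.ne _
  obtain ⟨t, ht⟩ := (ZMod.intCast_eq_intCast_iff_dvd_sub x y n).1 h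
  refine (Int.fract_eq_fract).2 ⟨-t, ?_⟩
  have : (y : ℚ) - x = n * t := by exact_mod_cast ht
  field_simp
  push_cast
  linarith

theorem fracPart_eq_fract (a : ZMod n) (x : ℤ) (h : (x : ZMod n) = a * l) :
    fracPart l a = Int.fract ((x : ℚ) / n) := by
  rw [fracPart, ← Int.fract_intCast_div_eq (x := a.val * l) (y := x) (by simp [h])]
  push_cast; rfl

/-- Multiplication by `k` fixes `l`, so `al`, and with it `{al/n}`, depends only on the orbit of
`a`. -/
theorem mul_eq_of_mem_orbitFinset (hl : (l : ZMod n) * k = l) {a b : ZMod n}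
    (h : b ∈ orbitFinset k a) : b * l = a * l := by
  obtain ⟨i, rfl⟩ := mem_orbitFinset.1 h
  have : (l : ZMod n) * (k : ZMod n) ^ i = l := by
    induction i with
    | zero => simp
    | succ i ih => rw [pow_succ, ← mul_assoc, ih (mem_orbitFinset.2 ⟨i, rfl⟩), hl]
  rw [mul_assoc, mul_comm _ (l : ZMod n), this]

theorem fracPart_eq_of_mem (hl : (l : ZMod n) * k = l) {a b : ZMod n}
    (h : b ∈ orbitFinset k a) : fracPart l b = fracPart l a := by
  rw [fracPart_eq_fract b (a.val * l) (by simp [mul_eq_of_mem_orbitFinset hl h]),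
    fracPart_eq_fract a (a.val * l) (by simp)]

omit [NeZero n] in
theorem fracPart_zero : fracPart l (0 : ZMod n) = 0 := by simp [fracPart]

theorem exists_int_fracPart {a b c : ZMod n} (h : a * l + b * l = c * (l : ZMod n)) :
    ∃ t : ℤ, fracPart l a + fracPart l b - fracPart l c = t := by
  have hn : (n : ℚ) ≠ 0 := NeZero.ne _
  rw [fracPart_eq_fract c (a.val * l + b.val * l) (by simp [h]),
    fracPart_eq_fract a (a.val * l) (by simp), fracPart_eq_fract b (b.val * l) (by simp)]
  simp only [Int.fract]
  refine ⟨⌊(((a.val * l + b.val * l : ℤ) : ℚ)) / n⌋ - ⌊((a.val * l : ℤ) : ℚ) / n⌋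
    - ⌊((b.val * l : ℤ) : ℚ) / n⌋, ?_⟩
  push_cast
  ring

omit [NeZero m] in
theorem gammaCond_congr (hl : (l : ZMod n) * k = l)
    {a b c c' : ZMod n} (h : c' ∈ orbitFinset k c) (α β γ : ℕ) :
    GammaCond k l m a b c' α β γ ↔ GammaCond k l m a b c α β γ := by
  rw [GammaCond, GammaCond, fracPart_eq_of_mem hl h]

theorem gammaSet_congr (hk : (k : ZMod n) ^ m = 1) (hl : (l : ZMod n) * k = l)
    {a b c c' : ZMod n} (h : c' ∈ orbitFinset k c) (α β : ℕ) :
    gammaSet k l m a b c' α β = gammaSet k l m a b c α β := by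
  ext γ
  simp only [gammaSet, Finset.mem_filter, stabSize_eq_of_mem hk h, gammaCond_congr hl h]

end Orbits

/-! ### Normal forms `y^j x^i` in the presented group -/

section Presentation

variable {n m : ℕ} [NeZero n] [NeZero m] {k l : ℤ}

/-- The element `y ^ j * x ^ i` of the metacyclic group. -/
def metacyclicElt (k l : ℤ) (m n : ℕ) (j : ℕ) (i : ℤ) : MetacyclicGroup k l m n :=
  PresentedGroup.of 1 ^ j * PresentedGroup.of 0 ^ i

omit [NeZero n] [NeZero m] in
theorem metacyclic_of_zero_pow :
    (PresentedGroup.of 0 : MetacyclicGroup k l m n) ^ n = 1 := by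
  have : (PresentedGroup.mk (metacyclicRels k l m n)) (FreeGroup.of 0 ^ n) = 1 :=
    PresentedGroup.one_of_mem (by simp [metacyclicRels])
  simpa using! this

omit [NeZero n] [NeZero m] in
theorem metacyclic_of_one_pow :
    (PresentedGroup.of 1 : MetacyclicGroup k l m n) ^ m = PresentedGroup.of 0 ^ l := by
  have : (PresentedGroup.mk (metacyclicRels k l m n))
      (FreeGroup.of 1 ^ m * (FreeGroup.of 0 ^ l)⁻¹) = 1 :=
    PresentedGroup.one_of_mem (by simp [metacyclicRels])
  rw [map_mul, map_inv, mul_inv_eq_one, map_pow, map_zpow] at this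
  exact this

omit [NeZero n] [NeZero m] in
theorem metacyclic_of_zero_mul_of_one :
    (PresentedGroup.of 0 : MetacyclicGroup k l m n) * PresentedGroup.of 1 =
      PresentedGroup.of 1 * PresentedGroup.of 0 ^ k := by
  have : (PresentedGroup.mk (metacyclicRels k l m n))
      ((FreeGroup.of 1)⁻¹ * FreeGroup.of 0 * FreeGroup.of 1 * (FreeGroup.of 0 ^ k)⁻¹) = 1 :=
    PresentedGroup.one_of_mem (by simp [metacyclicRels])
  rw [map_mul, map_inv _ (_ ^ _), mul_inv_eq_one, map_zpow, map_mul, map_mul, map_inv, mul_assoc,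
    inv_mul_eq_iff_eq_mul] at this
  exact this

omit [NeZero n] [NeZero m] in
theorem metacyclic_zpow_mul_pow (e : ℤ) (j : ℕ) :
    (PresentedGroup.of 0 : MetacyclicGroup k l m n) ^ e * PresentedGroup.of 1 ^ j =
      PresentedGroup.of 1 ^ j * PresentedGroup.of 0 ^ (k ^ j * e) := by
  have h : SemiconjBy (PresentedGroup.of 1 : MetacyclicGroup k l m n)
      (PresentedGroup.of 0 ^ k) (PresentedGroup.of 0) := metacyclic_of_zero_mul_of_one.symm
  suffices ∀ j : ℕ, SemiconjBy (PresentedGroup.of 1 ^ j : MetacyclicGroup k l m n)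
      (PresentedGroup.of 0 ^ (k ^ j)) (PresentedGroup.of 0) by
    have := (this j).zpow_right e
    rw [← zpow_mul] at this
    exact this.symm
  intro j
  induction j with
  | zero => simp
  | succ j ih =>
    rw [pow_succ]
    refine ih.mul_left ?_
    have := h.zpow_right (k ^ j)
    rwa [← zpow_mul, ← pow_succ'] at this

omit [NeZero n] [NeZero m] in
theorem metacyclicElt_congr {j : ℕ} {i i' : ℤ} (h : (i : ZMod n) = i') :
    metacyclicElt k l m n j i = metacyclicElt k l m n j i' := by
  obtain ⟨t, ht⟩ := (ZMod.intCast_eq_intCast_iff_dvd_sub i i' n).1 h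
  obtain rfl : i' = i + n * t := by linarith
  rw [metacyclicElt, metacyclicElt, zpow_add, zpow_mul, zpow_natCast, metacyclic_of_zero_pow,
    one_zpow, mul_one]

theorem exists_eq_metacyclicElt (g : MetacyclicGroup k l m n) :
    ∃ (j : ℕ) (i : ℤ), g = metacyclicElt k l m n j i := by
  have hx : ∀ (e : ℤ) (j : ℕ) (i : ℤ), PresentedGroup.of 0 ^ e * metacyclicElt k l m n j i =
      metacyclicElt k l m n j (k ^ j * e + i) := by
    intro e j i
    rw [metacyclicElt, ← mul_assoc, metacyclic_zpow_mul_pow, mul_assoc, ← zpow_add, metacyclicElt]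
  have hy : ∀ (e j : ℕ) (i : ℤ), PresentedGroup.of 1 ^ e * metacyclicElt k l m n j i =
      metacyclicElt k l m n (e + j) i := by
    intro e j i
    rw [metacyclicElt, ← mul_assoc, ← pow_add, metacyclicElt]
  have hord : (PresentedGroup.of 1 : MetacyclicGroup k l m n) ^ (m * n) = 1 := by
    rw [pow_mul, metacyclic_of_one_pow, ← zpow_natCast, zpow_comm, zpow_natCast,
      metacyclic_of_zero_pow, one_zpow]
  have hmn : 0 < m * n := Nat.mul_pos (NeZero.pos m) (NeZero.pos n)
  -- The exponent of `y` is a natural number, so left multiplication by `y⁻¹` needs a positive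
  -- power.
  have hinv : (PresentedGroup.of 1 : MetacyclicGroup k l m n)⁻¹ =
      PresentedGroup.of 1 ^ (m * n - 1) := by
    rw [inv_eq_iff_mul_eq_one, ← pow_succ', Nat.sub_add_cancel hmn, hord]
  have hg : g ∈ Subgroup.closure (Set.range PresentedGroup.of) := by
    rw [PresentedGroup.closure_range_of]; trivial
  induction hg using Subgroup.closure_induction_left with
  | one => exact ⟨0, 0, by simp [metacyclicElt]⟩
  | mul_left z hz g _ ih =>
    obtain ⟨j, i, rfl⟩ := ih
    obtain ⟨z, rfl⟩ := hz
    fin_cases z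
    · exact ⟨_, _, by simpa using! hx 1 j i⟩
    · exact ⟨_, _, by simpa using! hy 1 j i⟩
  | inv_mul_cancel z hz g _ ih =>
    obtain ⟨j, i, rfl⟩ := ih
    obtain ⟨z, rfl⟩ := hz
    fin_cases z
    · exact ⟨_, _, by simpa using! hx (-1) j i⟩
    · exact ⟨_, _, (congrArg (· * _) hinv).trans (hy (m * n - 1) j i)⟩

/-- The parametrization `(j, i) ↦ y ^ j * x ^ i` of the metacyclic group. -/
def metacyclicParam (k l : ℤ) (m n : ℕ) (p : Fin m × ZMod n) : MetacyclicGroup k l m n :=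
  metacyclicElt k l m n p.1 p.2.val

theorem metacyclicParam_surjective :
    Function.Surjective (metacyclicParam k l m n) := by
  intro g
  obtain ⟨j, i, rfl⟩ := exists_eq_metacyclicElt g
  have hm : 0 < m := NeZero.pos m
  -- Each full block `y^m` in `y^j` turns into `x^l`.
  refine ⟨(⟨j % m, Nat.mod_lt j hm⟩, ((l * (j / m : ℕ) + i : ℤ) : ZMod n)), ?_⟩
  rw [metacyclicParam, metacyclicElt_congr (i' := l * (j / m : ℕ) + i) (by simp),
    metacyclicElt, metacyclicElt]
  conv_rhs => rw [← Nat.mod_add_div j m, pow_add, pow_mul, metacyclic_of_one_pow, mul_assoc,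
    ← zpow_natCast (PresentedGroup.of 0 ^ l), ← zpow_mul, ← zpow_add]

theorem finite_metacyclicGroup : Finite (MetacyclicGroup k l m n) :=
  Finite.of_surjective _ metacyclicParam_surjective

-- The presentation alone bounds `|G|` only from above. The hypothesis, that no nontrivial normal
-- form collapses, is checked later by evaluating characters.
omit [NeZero m] in
theorem metacyclicParam_injective
    (h : ∀ j < m, ∀ i : ℤ, metacyclicElt k l m n j i = 1 → j = 0 ∧ (i : ZMod n) = 0) :
    Function.Injective (metacyclicParam k l m n) := by
  have key : ∀ p q : Fin m × ZMod n, (q.1 : ℕ) ≤ p.1 →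
      metacyclicParam k l m n p = metacyclicParam k l m n q → p = q := by
    intro p q hle hpq
    have h1 : metacyclicElt k l m n (p.1 - q.1) (p.2.val - q.2.val) = 1 := by
      rw [metacyclicParam, metacyclicParam, metacyclicElt, metacyclicElt,
        ← Nat.add_sub_cancel' hle, pow_add, mul_assoc, mul_right_inj] at hpq
      rw [metacyclicElt, zpow_sub, ← mul_assoc, hpq, mul_inv_cancel]
    obtain ⟨h2, h3⟩ := h _ (lt_of_le_of_lt (Nat.sub_le _ _) p.1.2) _ h1
    refine Prod.ext (Fin.ext (by omega)) ?_
    simpa [sub_eq_zero] using h3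
  intro p q hpq
  rcases le_total (q.1 : ℕ) p.1 with hle | hle
  · exact key p q hle hpq
  · exact (key q p hle hpq.symm).symm

end Presentation

/-! ### Monomial representations and their irreducibility -/

section Monomial

variable {n m : ℕ} [NeZero n] [NeZero m] {k l : ℤ} {ι : Type*}

/-- The diagonal map with eigenvalues `ζ ^ (-c t)`, for `ζ` the standard `n`-th root of unity. -/
noncomputable def diagEquiv (c : ι → ZMod n) : (ι → ℂ) ≃ₗ[ℂ] (ι → ℂ) :=
  LinearEquiv.piCongrRight fun t =>
    LinearEquiv.smulOfNeZero ℂ ℂ (ZMod.stdAddChar (-(c t)))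
      (IsUnit.ne_zero (AddChar.val_isUnit _ _))

/-- The permutation map of `σ`, scaled by `μ`. -/
noncomputable def permEquiv (σ : Equiv.Perm ι) (μ : ℂˣ) : (ι → ℂ) ≃ₗ[ℂ] (ι → ℂ) :=
  (LinearEquiv.funCongrLeft ℂ ℂ σ).trans (LinearEquiv.smulOfUnit μ)

theorem diagEquiv_apply (c : ι → ZMod n) (f : ι → ℂ) (t : ι) :
    diagEquiv c f t = ZMod.stdAddChar (-(c t)) * f t := rfl

theorem permEquiv_apply (σ : Equiv.Perm ι) (μ : ℂˣ) (f : ι → ℂ) (t : ι) :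
    permEquiv σ μ f t = μ * f (σ t) := rfl

theorem diagEquiv_pow_apply (c : ι → ZMod n) (i : ℕ) (f : ι → ℂ) (t : ι) :
    (diagEquiv c ^ i) f t = ZMod.stdAddChar (-(c t * (i : ZMod n))) * f t := by
  induction i generalizing f with
  | zero => simp
  | succ i ih =>
    rw [pow_succ, LinearEquiv.mul_apply, ih, diagEquiv_apply, ← mul_assoc, ← AddChar.map_add_eq_mul]
    congr 2
    push_cast
    ring

theorem diagEquiv_pow_card (c : ι → ZMod n) : diagEquiv c ^ n = 1 := by
  ext f t
  simp [diagEquiv_pow_apply]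

theorem diagEquiv_zpow_apply (c : ι → ZMod n) (i : ℤ) (f : ι → ℂ) (t : ι) :
    (diagEquiv c ^ i) f t = ZMod.stdAddChar (-(c t * (i : ZMod n))) * f t := by
  have h : diagEquiv c ^ i = diagEquiv c ^ ((i : ZMod n).val) := by
    rw [← zpow_natCast, ZMod.val_intCast]
    conv_lhs => rw [← Int.emod_add_mul_ediv i n, zpow_add, zpow_mul, zpow_natCast,
      diagEquiv_pow_card, one_zpow, mul_one]
  rw [h, diagEquiv_pow_apply, ZMod.natCast_zmod_val]

theorem permEquiv_pow_apply (σ : Equiv.Perm ι) (μ : ℂˣ) (j : ℕ) (f : ι → ℂ) (t : ι) :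
    (permEquiv σ μ ^ j) f t = (μ : ℂ) ^ j * f ((σ ^ j) t) := by
  induction j generalizing f with
  | zero => simp
  | succ j ih =>
    rw [pow_succ, LinearEquiv.mul_apply, ih, permEquiv_apply, ← mul_assoc, ← pow_succ, pow_succ' σ,
      Equiv.Perm.mul_apply]

/-- The data of a monomial representation of `M(k, l, m, n)`: in a basis indexed by `ι`, the
generator `x` is diagonal and `y` permutes the basis up to the scalar `μ`. -/
structure IsMonomialDatum (k l : ℤ) (m : ℕ) (c : ι → ZMod n) (σ : Equiv.Perm ι) (μ : ℂˣ) :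
    Prop where
  injective : Function.Injective c
  perm : ∀ t, c (σ t) * k = c t
  scalar : ∀ t, (μ : ℂ) ^ m = ZMod.stdAddChar (-(c t * (l : ZMod n)))
  transitive : ∀ s t, ∃ j : ℕ, c s = c t * (k : ZMod n) ^ j

namespace IsMonomialDatum

variable {c : ι → ZMod n} {σ : Equiv.Perm ι} {μ : ℂˣ}

omit [NeZero m] in
theorem pow_perm (h : IsMonomialDatum k l m c σ μ) (j : ℕ) (t : ι) :
    c ((σ ^ j) t) * (k : ZMod n) ^ j = c t := by
  induction j generalizing t with
  | zero => simp
  | succ j ih =>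
    rw [pow_succ, Equiv.Perm.mul_apply, pow_succ, ← mul_assoc, ih, h.perm]

theorem pow_perm_eq_iff (h : IsMonomialDatum k l m c σ μ) (hk : (k : ZMod n) ^ m = 1)
    (j : ℕ) (s t : ι) : (σ ^ j) s = t ↔ c t * (k : ZMod n) ^ j = c s := by
  constructor
  · rintro rfl
    exact h.pow_perm j s
  · intro hst
    refine h.injective ?_
    rw [← h.pow_perm j s] at hst
    have hu : IsUnit ((k : ZMod n) ^ j) := (IsUnit.of_mul_eq_one _ (pow_mul_eq_one hk j))
    exact (hu.mul_left_injective hst).symm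

/-- The field `scalar` encodes `y^m = x^l` (with `σ^m = 1`), and `perm` encodes `xy = yx^k`; `x^n =
1` holds for any diagonal of `n`-th roots of unity. -/
theorem lift_eq_one (h : IsMonomialDatum k l m c σ μ) (hk : (k : ZMod n) ^ m = 1) :
    ∀ r ∈ metacyclicRels k l m n,
      FreeGroup.lift (![diagEquiv c, permEquiv σ μ] : Fin 2 → _) r = 1 := by
  intro r hr
  simp only [metacyclicRels, Set.mem_insert_iff, Set.mem_singleton_iff] at hr
  rcases hr with rfl | rfl | rfl
  · rw [map_mul, map_inv, map_pow, map_zpow, mul_inv_eq_one, FreeGroup.lift_apply_of,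
      FreeGroup.lift_apply_of]
    ext f t
    have : (σ ^ m) t = t := by rw [h.pow_perm_eq_iff hk, hk, mul_one]
    change (permEquiv σ μ ^ m) f t = (diagEquiv c ^ l) f t
    rw [permEquiv_pow_apply, diagEquiv_zpow_apply, this, h.scalar t]
  · rw [map_pow, FreeGroup.lift_apply_of]
    exact diagEquiv_pow_card c
  · rw [map_mul, map_inv _ (_ ^ _), map_zpow, mul_inv_eq_one, map_mul, map_mul, map_inv, mul_assoc,
      inv_mul_eq_iff_eq_mul, FreeGroup.lift_apply_of, FreeGroup.lift_apply_of]
    ext f t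
    change diagEquiv c (permEquiv σ μ f) t = permEquiv σ μ ((diagEquiv c ^ k) f) t
    rw [diagEquiv_apply, permEquiv_apply, permEquiv_apply, diagEquiv_zpow_apply, h.perm]
    ring

/-- The monomial representation on `ι → ℂ`. -/
noncomputable def rep (h : IsMonomialDatum k l m c σ μ) (hk : (k : ZMod n) ^ m = 1) :
    Representation ℂ (MetacyclicGroup k l m n) (ι → ℂ) :=
  LinearEquiv.automorphismGroup.toLinearMapMonoidHom.comp
    (PresentedGroup.toGroup (h.lift_eq_one hk))

theorem rep_metacyclicElt_apply (h : IsMonomialDatum k l m c σ μ) (hk : (k : ZMod n) ^ m = 1)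
    (j : ℕ) (i : ℤ) (f : ι → ℂ) (t : ι) :
    h.rep hk (metacyclicElt k l m n j i) f t =
      (μ : ℂ) ^ j * (ZMod.stdAddChar (-(c ((σ ^ j) t) * (i : ZMod n))) * f ((σ ^ j) t)) := by
  have : PresentedGroup.toGroup (h.lift_eq_one hk) (metacyclicElt k l m n j i) =
      permEquiv σ μ ^ j * diagEquiv c ^ i := by
    rw [metacyclicElt, map_mul, map_pow, map_zpow, PresentedGroup.toGroup.of,
      PresentedGroup.toGroup.of]
    rfl
  change (PresentedGroup.toGroup (h.lift_eq_one hk) (metacyclicElt k l m n j i)) f t = _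
  rw [this, LinearEquiv.mul_apply, permEquiv_pow_apply, diagEquiv_zpow_apply]

theorem character_metacyclicElt [Fintype ι] (h : IsMonomialDatum k l m c σ μ) (hk : (k : ZMod n) ^ m = 1)
    (j : ℕ) (i : ℤ) :
    (h.rep hk).character (metacyclicElt k l m n j i) =
      ∑ t, if c t * (k : ZMod n) ^ j = c t then
        (μ : ℂ) ^ j * ZMod.stdAddChar (-(c t * (i : ZMod n))) else 0 := by
  classical
  rw [Representation.character, LinearMap.trace_eq_matrix_trace ℂ (Pi.basisFun ℂ ι), Matrix.trace]
  refine Finset.sum_congr rfl fun t _ => ?_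
  rw [Matrix.diag_apply, LinearMap.toMatrix_apply, Pi.basisFun_repr, Pi.basisFun_apply,
    rep_metacyclicElt_apply]
  simp only [← h.pow_perm_eq_iff hk]
  split_ifs with ht
  · simp [ht]
  · simp [ht]

/-- The eigenvalues of `x` are distinct, so a nonzero invariant subspace contains a basis vector;
powers of `y` then reach all the others up to scalars. -/
theorem isIrreducible_rep [Finite ι] [Nonempty ι] (h : IsMonomialDatum k l m c σ μ)
    (hk : (k : ZMod n) ^ m = 1) : (h.rep hk).IsIrreducible := by
  classical
  cases nonempty_fintype ι
  have hsingle : ∀ W : Subrepresentation (h.rep hk), ∀ f ∈ W.toSubmodule, ∀ t, f t ≠ 0 →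
      Pi.single t 1 ∈ W.toSubmodule := by
    intro W f hf t hft
    -- This is `n` times the projection to the eigenline of `x` at `t`, written as a Fourier sum
    -- over the powers of `x`.
    have hmem : ∑ i : ZMod n, ZMod.stdAddChar (c t * i) •
        h.rep hk (metacyclicElt k l m n 0 i.val) f ∈ W.toSubmodule :=
      Submodule.sum_mem _ fun i _ => Submodule.smul_mem _ _ (W.apply_mem_toSubmodule _ hf)
    have heq : ∑ i : ZMod n, ZMod.stdAddChar (c t * i) •
        h.rep hk (metacyclicElt k l m n 0 i.val) f = ((n : ℂ) * f t) • Pi.single t (1 : ℂ) := by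
      ext s
      simp only [Finset.sum_apply, Pi.smul_apply, rep_metacyclicElt_apply, smul_eq_mul, pow_zero,
        one_mul, Equiv.Perm.one_apply, Int.cast_natCast, ZMod.natCast_zmod_val]
      have : ∀ i : ZMod n, ZMod.stdAddChar (c t * i) * (ZMod.stdAddChar (-(c s * i)) * f s) =
          ZMod.stdAddChar (i * (c t - c s)) * f s := by
        intro i
        rw [← mul_assoc, ← AddChar.map_add_eq_mul]
        congr 2
        ring
      rw [Finset.sum_congr rfl fun i _ => this i, ← Finset.sum_mul,
        AddChar.sum_mulShift _ (ZMod.isPrimitive_stdAddChar n), ZMod.card]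
      by_cases hst : s = t
      · subst hst; simp
      · have : c t - c s ≠ 0 := fun h0 => hst (h.injective (sub_eq_zero.1 h0)).symm
        simp [hst, this]
    rw [heq] at hmem
    exact (Submodule.smul_mem_iff _ (mul_ne_zero (NeZero.ne _) hft)).1 hmem
  have htop : ∀ W : Subrepresentation (h.rep hk), ∀ t, Pi.single t 1 ∈ W.toSubmodule →
      W = ⊤ := by
    intro W t ht
    have hall : ∀ s, Pi.single s 1 ∈ W.toSubmodule := by
      intro s
      obtain ⟨j, hj⟩ := h.transitive s t
      refine hsingle W _ (W.apply_mem_toSubmodule (metacyclicElt k l m n j 0) ht) s ?_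
      rw [rep_metacyclicElt_apply, (h.pow_perm_eq_iff hk j s t).2 hj.symm]
      simp
    apply Subrepresentation.toSubmodule_injective
    refine eq_top_iff.2 fun f _ => ?_
    have hsum : ∑ s, f s • Pi.single s (1 : ℂ) ∈ W.toSubmodule :=
      Submodule.sum_mem _ fun s _ => Submodule.smul_mem _ _ (hall s)
    rwa [← pi_eq_sum_univ' f] at hsum
  have hbot : ∀ W : Subrepresentation (h.rep hk), W = ⊥ ∨ W = ⊤ := by
    intro W
    by_cases hW : W.toSubmodule = ⊥
    · exact Or.inl (Subrepresentation.toSubmodule_injective hW)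
    · obtain ⟨f, hf, hf0⟩ := Submodule.exists_mem_ne_zero_of_ne_bot hW
      obtain ⟨t, ht⟩ := Function.ne_iff.1 hf0
      exact Or.inr (htop W t (hsingle W f hf t ht))
  have hne : (⊥ : Subrepresentation (h.rep hk)) ≠ ⊤ := by
    intro h0
    have : (⊥ : Submodule ℂ (ι → ℂ)) = ⊤ := congrArg Subrepresentation.toSubmodule h0
    exact bot_ne_top this
  exact { exists_pair_ne := ⟨_, _, hne⟩, eq_bot_or_eq_top := hbot }

end IsMonomialDatum

end Monomial

/-! ### The characters `χ_{a,α}` and their inner products -/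

section Characters

variable {n m : ℕ} [NeZero n] [NeZero m] {k l : ℤ}

/-- The scalar `exp (2πi (α - {al/n}) / m)`. -/
noncomputable def phase (l : ℤ) (m : ℕ) (a : ZMod n) (α : ℕ) : ℂ :=
  Complex.exp (2 * Real.pi * Complex.I * (((α : ℚ) - fracPart l a : ℚ) : ℂ) / m)

theorem phase_pow_card (a : ZMod n) (α : ℕ) :
    phase l m a α ^ m = ZMod.stdAddChar (-(a * (l : ZMod n))) := by
  have hm : (m : ℂ) ≠ 0 := NeZero.ne _
  have hn : (n : ℂ) ≠ 0 := NeZero.ne _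
  have hx : -(a * (l : ZMod n)) = ((-(a.val * l) : ℤ) : ZMod n) := by simp
  rw [hx, ZMod.stdAddChar_coe, phase, ← Complex.exp_nat_mul, Complex.exp_eq_exp_iff_exists_int,
    fracPart, Int.fract]
  -- `α - {al/n}` exceeds `-al/n` by exactly this integer.
  refine ⟨α + ⌊(a.val : ℚ) * l / n⌋, ?_⟩
  push_cast
  field_simp
  ring

omit [NeZero n] [NeZero m] in
theorem phase_eq_mul (a : ZMod n) (α : ℕ) :
    phase l m a α = phase l m a 0 * Complex.exp (2 * Real.pi * Complex.I / m) ^ α := by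
  rw [phase, phase, ← Complex.exp_nat_mul, ← Complex.exp_add]
  congr 1
  push_cast
  ring

omit [NeZero n] [NeZero m] in
theorem phase_mul_phase_mul_conj_phase (a b c : ZMod n) (α β γ : ℕ) :
    phase l m a α * phase l m b β * (starRingEnd ℂ) (phase l m c γ) =
      Complex.exp (2 * Real.pi * Complex.I * ((((α : ℚ) + β - γ) -
        (fracPart l a + fracPart l b - fracPart l c) : ℚ) : ℂ) / m) := by
  rw [phase, phase, phase, ← Complex.exp_conj, ← Complex.exp_add, ← Complex.exp_add]
  congr 1
  simp only [map_div₀, map_mul, Complex.conj_I, Complex.conj_ofReal, map_ofNat, map_natCast,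
    map_ratCast]
  push_cast
  ring

theorem sum_pow_eq_ite {g : ℕ} {z : ℂ} (hz : z ^ g = 1) :
    ∑ t ∈ Finset.range g, z ^ t = if z = 1 then (g : ℂ) else 0 := by
  split_ifs with h
  · simp [h]
  · rw [geom_sum_eq h, hz, sub_self, zero_div]

/-- Multiplication by `k⁻¹` on the orbit of `a`. -/
def orbitPerm (hk : (k : ZMod n) ^ m = 1) (a : ZMod n) : Equiv.Perm (orbitFinset k a) where
  toFun b := ⟨b * (k : ZMod n) ^ (m - 1), mul_pow_mem_orbitFinset b.2 _⟩
  invFun b := ⟨b * (k : ZMod n) ^ 1, mul_pow_mem_orbitFinset b.2 _⟩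
  left_inv b := Subtype.ext (by
    change b.1 * _ * _ = b.1
    rw [mul_assoc, ← pow_add, Nat.sub_add_cancel NeZero.one_le, hk, mul_one])
  right_inv b := Subtype.ext (by
    change b.1 * _ * _ = b.1
    rw [mul_assoc, ← pow_add, Nat.add_sub_cancel' NeZero.one_le, hk, mul_one])

/-- The basis is the orbit of `a`, renumbered by `Fin` as `irrChar` requires. The power `y^j` fixes
either every basis line or none, because stabilizers are constant on the orbit. -/
theorem exists_irrChar (hk : (k : ZMod n) ^ m = 1) (hl : (l : ZMod n) * k = l) (a : ZMod n)
    (α : ℕ) : ∃ θ : irrChar (MetacyclicGroup k l m n), ∀ (j : ℕ) (i : ℤ),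
      θ.1 (metacyclicElt k l m n j i) = if orbitSize k a ∣ j then
        phase l m a α ^ j * ∑ b ∈ orbitFinset k a, ZMod.stdAddChar (-(b * (i : ZMod n)))
        else 0 := by
  let e : Fin (orbitSize k a) ≃ orbitFinset k a := (orbitFinset k a).equivFin.symm
  have : Nonempty (Fin (orbitSize k a)) := ⟨⟨0, orbitSize_pos a⟩⟩
  have h : IsMonomialDatum k l m (fun t => (e t : ZMod n)) ((e.trans (orbitPerm hk a)).trans e.symm)
      (Units.mk0 (phase l m a α) (Complex.exp_ne_zero _)) :=
    { injective := Subtype.val_injective.comp e.injective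
      perm := fun t => by
        have : ((orbitPerm hk a).symm (orbitPerm hk a (e t)) : ZMod n) = e t := by
          rw [Equiv.symm_apply_apply]
        simpa [orbitPerm] using this
      scalar := fun t => by
        rw [mul_eq_of_mem_orbitFinset hl (e t).2]
        exact phase_pow_card a α
      transitive := fun s t => by
        have : (e s : ZMod n) ∈ orbitFinset k (e t : ZMod n) := by
          rw [orbitFinset_eq_of_mem hk (e t).2]
          exact (e s).2
        exact mem_orbitFinset.1 this }
  refine ⟨⟨(h.rep hk).character, _, _, h.isIrreducible_rep hk, rfl⟩, fun j i => ?_⟩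
  change (h.rep hk).character _ = _
  have hfix : ∀ t, (e t : ZMod n) * (k : ZMod n) ^ j = e t ↔ orbitSize k a ∣ j := fun t => by
    rw [mul_pow_eq_self_iff hk, orbitSize_eq_of_mem hk (e t).2]
  rw [h.character_metacyclicElt]
  simp only [hfix]
  split_ifs
  · rw [← Finset.mul_sum, e.sum_comp fun b => ZMod.stdAddChar (-((b : ZMod n) * (i : ZMod n))),
      Finset.sum_coe_sort _ fun b => ZMod.stdAddChar (-(b * (i : ZMod n)))]
    rfl
  · simp

/-- The irreducible character `χ_{a,α}` of the metacyclic group. -/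
noncomputable def metacyclicChar (hk : (k : ZMod n) ^ m = 1) (hl : (l : ZMod n) * k = l)
    (a : ZMod n) (α : ℕ) : irrChar (MetacyclicGroup k l m n) :=
  (exists_irrChar hk hl a α).choose

theorem metacyclicChar_apply (hk : (k : ZMod n) ^ m = 1) (hl : (l : ZMod n) * k = l)
    (a : ZMod n) (α : ℕ) (j : ℕ) (i : ℤ) :
    (metacyclicChar hk hl a α).1 (metacyclicElt k l m n j i) = if orbitSize k a ∣ j then
      phase l m a α ^ j * ∑ b ∈ orbitFinset k a, ZMod.stdAddChar (-(b * (i : ZMod n)))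
      else 0 :=
  (exists_irrChar hk hl a α).choose_spec j i

omit [NeZero n] [NeZero m] in
theorem metacyclicElt_zero : metacyclicElt k l m n 0 0 = 1 := by simp [metacyclicElt]

theorem metacyclicChar_one (hk : (k : ZMod n) ^ m = 1) (hl : (l : ZMod n) * k = l)
    (a : ZMod n) (α : ℕ) : (metacyclicChar hk hl a α).1 1 = orbitSize k a := by
  rw [← metacyclicElt_zero, metacyclicChar_apply]
  simp [orbitSize]

/-- A geometric series in `α` with ratio `exp(2πi j/m)`, whose `s_a`-th power is `1` since `r_a ∣
j`. As `j < m`, the ratio is `1` only for `j = 0`. -/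
theorem sum_phase_pow (hk : (k : ZMod n) ^ m = 1) (a : ZMod n) {j : ℕ}
    (hj : j < m) (hd : orbitSize k a ∣ j) :
    ∑ α ∈ Finset.range (stabSize k m a), phase l m a α ^ j =
      if j = 0 then (stabSize k m a : ℂ) else 0 := by
  have hω := Complex.isPrimitiveRoot_exp m (NeZero.ne m)
  have h1 : ∀ α : ℕ, phase l m a α ^ j =
      phase l m a 0 ^ j * (Complex.exp (2 * Real.pi * Complex.I / m) ^ j) ^ α := by
    intro α
    rw [phase_eq_mul, mul_pow, pow_right_comm]
  have h2 : (Complex.exp (2 * Real.pi * Complex.I / m) ^ j) ^ stabSize k m a = 1 := by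
    obtain ⟨t, rfl⟩ := hd
    rw [← pow_mul, mul_right_comm (orbitSize k a), orbitSize_mul_stabSize hk, pow_mul, hω.pow_eq_one, one_pow]
  rw [Finset.sum_congr rfl fun α _ => h1 α, ← Finset.mul_sum, sum_pow_eq_ite h2]
  simp only [hω.pow_eq_one_iff_dvd]
  by_cases h0 : j = 0
  · simp [h0]
  · rw [if_neg h0, if_neg fun h => h0 (Nat.eq_zero_of_dvd_of_lt h hj), mul_zero]

/-- The regular character, computed on words before it is known that they are distinct. Summing over
`α` kills `j ≠ 0` and leaves the factor `r_a s_a = m`; the orbits then combine to a full character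
sum over `ℤ/n`. -/
theorem sum_orbitSize_mul_metacyclicChar (hk : (k : ZMod n) ^ m = 1) (hl : (l : ZMod n) * k = l)
    {I : Finset (ZMod n)} (hI : IsOrbitRepresentatives k I) {j : ℕ} (hj : j < m) (i : ℤ) :
    ∑ a ∈ I, ∑ α ∈ Finset.range (stabSize k m a),
      (orbitSize k a : ℂ) * (metacyclicChar hk hl a α).1 (metacyclicElt k l m n j i) =
      if j = 0 ∧ (i : ZMod n) = 0 then (m : ℂ) * n else 0 := by
  have h1 : ∀ a ∈ I, ∑ α ∈ Finset.range (stabSize k m a),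
      (orbitSize k a : ℂ) * (metacyclicChar hk hl a α).1 (metacyclicElt k l m n j i) =
      ∑ b ∈ orbitFinset k a, if j = 0 then
        (m : ℂ) * ZMod.stdAddChar (-(b * (i : ZMod n))) else 0 := by
    intro a _
    simp_rw [metacyclicChar_apply]
    by_cases hd : orbitSize k a ∣ j
    · simp only [if_pos hd]
      rw [← Finset.mul_sum, ← Finset.sum_mul, sum_phase_pow hk a hj hd]
      split_ifs
      · rw [← mul_assoc, ← Nat.cast_mul, orbitSize_mul_stabSize hk, Finset.mul_sum]
      · simp
    · have : j ≠ 0 := fun h => hd (h ▸ dvd_zero _)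
      simp [hd, this]
  rw [Finset.sum_congr rfl h1, sum_sum_orbitFinset hk hI]
  by_cases h0 : j = 0
  · simp only [h0, if_true, true_and]
    have h2 : ∀ b : ZMod n, ZMod.stdAddChar (-(b * (i : ZMod n))) =
        ZMod.stdAddChar (b * -(i : ZMod n)) := fun b => by rw [mul_neg]
    rw [← Finset.mul_sum, Finset.sum_congr rfl fun b _ => h2 b,
      AddChar.sum_mulShift _ (ZMod.isPrimitive_stdAddChar n), ZMod.card]
    simp
  · simp [h0]

/-- A word equal to `1` must give the regular sum its value `mn ≠ 0` at the identity, so the word is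
trivial. -/
theorem metacyclicParam_bijective (hk : (k : ZMod n) ^ m = 1) (hl : (l : ZMod n) * k = l)
    {I : Finset (ZMod n)} (hI : IsOrbitRepresentatives k I) :
    Function.Bijective (metacyclicParam k l m n) := by
  refine ⟨metacyclicParam_injective fun j hj i h => ?_, metacyclicParam_surjective⟩
  have h1 := sum_orbitSize_mul_metacyclicChar hk hl hI hj i
  have h2 := sum_orbitSize_mul_metacyclicChar hk hl hI (NeZero.pos m) 0
  rw [h, ← metacyclicElt_zero, h2] at h1
  by_contra hne
  simp [hne, NeZero.ne] at h1

theorem card_metacyclicGroup (hk : (k : ZMod n) ^ m = 1) (hl : (l : ZMod n) * k = l)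
    {I : Finset (ZMod n)} (hI : IsOrbitRepresentatives k I) :
    Nat.card (MetacyclicGroup k l m n) = m * n := by
  rw [← Nat.card_eq_of_bijective _ (metacyclicParam_bijective hk hl hI)]
  simp

theorem finsum_metacyclicGroup (hk : (k : ZMod n) ^ m = 1) (hl : (l : ZMod n) * k = l)
    {I : Finset (ZMod n)} (hI : IsOrbitRepresentatives k I) (F : MetacyclicGroup k l m n → ℂ) :
    ∑ᶠ g, F g = ∑ j ∈ Finset.range m, ∑ i : ZMod n, F (metacyclicElt k l m n j i.val) := by
  rw [← finsum_eq_of_bijective _ (metacyclicParam_bijective hk hl hI) (fun _ => rfl),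
    finsum_eq_sum_of_fintype, Fintype.sum_prod_type, Finset.sum_range]
  rfl

open Classical in
theorem charInner_metacyclicChar (hk : (k : ZMod n) ^ m = 1) (hl : (l : ZMod n) * k = l)
    {I : Finset (ZMod n)} (hI : IsOrbitRepresentatives k I) (a b c : ZMod n) (α β γ : ℕ) :
    (m : ℂ) * charInner ((metacyclicChar hk hl a α).1 * (metacyclicChar hk hl b β).1)
      (metacyclicChar hk hl c γ).1 = if GammaCond k l m a b c α β γ then
        (Nat.gcd (stabSize k m a) (stabSize k m b) * (orbitSize k c * orbitSumCount k a b c) : ℂ)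
        else 0 := by
  have hm : (m : ℂ) ≠ 0 := NeZero.ne _
  have hn : (n : ℂ) ≠ 0 := NeZero.ne _
  set E := phase l m a α * phase l m b β * (starRingEnd ℂ) (phase l m c γ) with hE
  have hterm : ∀ (j : ℕ) (i : ZMod n),
      ((metacyclicChar hk hl a α).1 * (metacyclicChar hk hl b β).1) (metacyclicElt k l m n j i.val)
        * (starRingEnd ℂ) ((metacyclicChar hk hl c γ).1 (metacyclicElt k l m n j i.val)) =
      if orbitSize k a ∣ j ∧ orbitSize k b ∣ j ∧ orbitSize k c ∣ j then
        E ^ j * ∑ r ∈ orbitFinset k a, ∑ s ∈ orbitFinset k b, ∑ t ∈ orbitFinset k c,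
          ZMod.stdAddChar (i * (t - (r + s))) else 0 := by
    intro j i
    rw [Pi.mul_apply, metacyclicChar_apply, metacyclicChar_apply, metacyclicChar_apply]
    by_cases ha : orbitSize k a ∣ j
    swap; · simp [ha]
    by_cases hb : orbitSize k b ∣ j
    swap; · simp [hb]
    by_cases hc : orbitSize k c ∣ j
    swap; · simp [hc]
    simp only [ha, hb, hc, and_self, if_true, Int.cast_natCast, ZMod.natCast_zmod_val]
    have h1 : ∀ r s t : ZMod n, ZMod.stdAddChar (i * (t - (r + s))) =
        ZMod.stdAddChar (-(r * i)) * ZMod.stdAddChar (-(s * i)) *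
          (starRingEnd ℂ) (ZMod.stdAddChar (-(t * i))) := by
      intro r s t
      rw [← AddChar.map_neg_eq_conj, ← AddChar.map_add_eq_mul, ← AddChar.map_add_eq_mul]
      congr 1
      ring
    simp_rw [h1, ← Finset.mul_sum, ← Finset.sum_mul, ← Finset.mul_sum, ← Finset.sum_mul, map_mul, map_pow, map_sum, hE]
    ring
  have hsum : ∀ j : ℕ, ∑ i : ZMod n,
      ((metacyclicChar hk hl a α).1 * (metacyclicChar hk hl b β).1) (metacyclicElt k l m n j i.val)
        * (starRingEnd ℂ) ((metacyclicChar hk hl c γ).1 (metacyclicElt k l m n j i.val)) =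
      if orbitSize k a ∣ j ∧ orbitSize k b ∣ j ∧ orbitSize k c ∣ j then
        E ^ j * (n * (orbitSize k c * orbitSumCount k a b c)) else 0 := by
    intro j
    simp_rw [hterm]
    split_ifs with hj
    · rw [← Finset.mul_sum]
      congr 1
      have h2 : (orbitSize k c * orbitSumCount k a b c : ℂ) =
          ∑ r ∈ orbitFinset k a, ∑ s ∈ orbitFinset k b, ∑ t ∈ orbitFinset k c,
            if r + s = t then 1 else 0 := by
        exact_mod_cast (sum_orbits_ite_add_eq hk a b c).symm
      rw [h2, Finset.sum_comm, Finset.mul_sum]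
      refine Finset.sum_congr rfl fun r _ => ?_
      rw [Finset.sum_comm, Finset.mul_sum]
      refine Finset.sum_congr rfl fun s _ => ?_
      rw [Finset.sum_comm, Finset.mul_sum]
      refine Finset.sum_congr rfl fun t _ => ?_
      rw [AddChar.sum_mulShift _ (ZMod.isPrimitive_stdAddChar n), ZMod.card]
      by_cases hrs : r + s = t
      · simp [hrs]
      · rw [if_neg hrs, if_neg fun h => hrs (sub_eq_zero.1 h).symm]; simp
    · simp
  rw [charInner, card_metacyclicGroup hk hl hI, finsum_metacyclicGroup hk hl hI,
    Finset.sum_congr rfl fun j _ => hsum j, ← Finset.sum_filter, ← Finset.sum_mul]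
  -- If no orbit elements satisfy `r + s = c`, both sides vanish. Otherwise `c` may be taken to be
  -- `r + s`, which makes the condition on `r_c` redundant and the fractional parts additive mod
  -- `1`.
  by_cases hS : orbitSumCount k a b c = 0
  · simp [hS]
  obtain ⟨r, hr, s, hs, rfl⟩ := exists_mem_of_orbitSumCount_ne_zero hS
  set L := (orbitSize k a).lcm (orbitSize k b) with hL
  set g := (stabSize k m a).gcd (stabSize k m b) with hg
  have hLg : L * g = m := by
    rw [hL, hg, Nat.lcm_mul_gcd_of_mul_eq (stabSize_pos hk a), orbitSize_mul_stabSize hk]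
    rw [orbitSize_mul_stabSize hk, orbitSize_mul_stabSize hk]
  have hLpos : 0 < L := Nat.lcm_pos (orbitSize_pos a) (orbitSize_pos b)
  have hgpos : 0 < g := Nat.gcd_pos_of_pos_left _ (stabSize_pos hk a)
  have hfilter : (Finset.range m).filter (fun j => orbitSize k a ∣ j ∧ orbitSize k b ∣ j ∧
      orbitSize k (r + s) ∣ j) = (Finset.range (L * g)).filter (L ∣ ·) := by
    rw [hLg]
    refine Finset.filter_congr fun j _ => ?_
    rw [hL, Nat.lcm_dvd_iff]
    refine ⟨fun h => ⟨h.1, h.2.1⟩, fun h => ⟨h.1, h.2, ?_⟩⟩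
    -- If `k^j` fixes `r` and `s`, it fixes `r + s`.
    have h1 := (mul_pow_eq_self_iff hk r j).2 (by rw [orbitSize_eq_of_mem hk hr]; exact h.1)
    have h2 := (mul_pow_eq_self_iff hk s j).2 (by rw [orbitSize_eq_of_mem hk hs]; exact h.2)
    rw [← mul_pow_eq_self_iff hk, add_mul, h1, h2]
  obtain ⟨u, hu⟩ := exists_int_fracPart (l := l) (a := a) (b := b) (c := r + s) (by
    rw [add_mul, mul_eq_of_mem_orbitFinset hl hr, mul_eq_of_mem_orbitFinset hl hs])
  have hEg : (E ^ L) ^ g = 1 := by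
    rw [← pow_mul, hLg, hE, phase_mul_phase_mul_conj_phase, hu, ← Complex.exp_nat_mul,
      Complex.exp_eq_one_iff]
    refine ⟨α + β - γ - u, ?_⟩
    push_cast
    field_simp
  -- Since `L / m = 1 / g`, the ratio `E^L` is `exp(2πi δ/g)`, with `δ` the difference of the two
  -- sides of the congruence.
  have hEL : E ^ L = 1 ↔ GammaCond k l m a b (r + s) α β γ := by
    rw [hE, phase_mul_phase_mul_conj_phase, ← Complex.exp_nat_mul, Complex.exp_eq_one_iff,
      GammaCond]
    refine exists_congr fun t => ?_
    rw [← hg, ← Rat.cast_inj (α := ℂ), ← hLg]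
    have hL0 : (L : ℂ) ≠ 0 := by exact_mod_cast hLpos.ne'
    have hg0 : (g : ℂ) ≠ 0 := by exact_mod_cast hgpos.ne'
    have hpi : (2 * Real.pi * Complex.I : ℂ) ≠ 0 := Complex.two_pi_I_ne_zero
    push_cast
    rw [show ∀ x : ℂ, (L : ℂ) * (2 * Real.pi * Complex.I * x / (L * g)) =
      (x / g) * (2 * Real.pi * Complex.I) by intro x; field_simp, mul_left_inj' hpi,
      div_eq_iff hg0]
  rw [hfilter, sum_range_filter_dvd _ _ hLpos]
  simp_rw [pow_mul]
  rw [sum_pow_eq_ite hEg]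
  simp only [hEL]
  split_ifs
  · push_cast
    field_simp
  · simp

end Characters

/-! ### The `χ_{a,α}` are all the irreducible characters, without repetition -/

section Completeness

theorem irrChar_apply_one_ne_zero {G : Type*} [Group G] (θ : irrChar G) : θ.1 1 ≠ 0 := by
  obtain ⟨_, d, ρ, hρ, rfl⟩ := θ
  change ρ.character 1 ≠ 0
  rw [Representation.char_one, Module.finrank_fin_fun]
  rintro h
  obtain rfl : d = 0 := by exact_mod_cast h
  obtain ⟨x, y, hxy⟩ := hρ.exists_pair_ne
  exact hxy (Subrepresentation.toSubmodule_injective (Subsingleton.elim _ _))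

theorem sum_irrChar_mul_inv_eq_zero {G : Type*} [Group G] [Fintype G] {θ φ : irrChar G}
    (h : θ ≠ φ) : ∑ g, θ.1 g * φ.1 g⁻¹ = 0 := by
  obtain ⟨_, d, ρ, hρ, rfl⟩ := θ
  obtain ⟨_, e, σ, hσ, rfl⟩ := φ
  have hG : (Nat.card G : ℂ) ≠ 0 := Nat.cast_ne_zero.2 Nat.card_pos.ne'
  have := invertibleOfNonzero hG
  have h1 := Representation.char_orthonormal ρ σ
  rw [if_neg fun ⟨e⟩ => h (Subtype.ext (Representation.char_iso e).symm)] at h1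
  exact (mul_eq_zero.1 h1).resolve_left (inv_ne_zero hG)

variable {n m : ℕ} [NeZero n] [NeZero m] {k l : ℤ}

/-- An irreducible `θ` different from all `χ_{a,α}` would be orthogonal to the regular character,
but that pairing is `mn θ(1) ≠ 0`. -/
theorem exists_metacyclicChar_eq (hk : (k : ZMod n) ^ m = 1) (hl : (l : ZMod n) * k = l)
    {I : Finset (ZMod n)} (hI : IsOrbitRepresentatives k I)
    (θ : irrChar (MetacyclicGroup k l m n)) :
    ∃ a ∈ I, ∃ α < stabSize k m a, metacyclicChar hk hl a α = θ := by
  classical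
  by_contra! hθ
  have := finite_metacyclicGroup (k := k) (l := l) (m := m) (n := n)
  cases nonempty_fintype (MetacyclicGroup k l m n)
  have hreg : ∀ g : MetacyclicGroup k l m n, ∑ a ∈ I, ∑ α ∈ Finset.range (stabSize k m a),
      (orbitSize k a : ℂ) * (metacyclicChar hk hl a α).1 g =
      if g = 1 then (m : ℂ) * n else 0 := by
    intro g
    obtain ⟨⟨j, i⟩, rfl⟩ := metacyclicParam_surjective g
    have h1 : metacyclicParam k l m n (⟨0, NeZero.pos m⟩, 0) = 1 := by
      simp [metacyclicParam, metacyclicElt]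
    have h2 := (metacyclicParam_bijective hk hl hI).1.eq_iff (a := (j, i))
      (b := (⟨0, NeZero.pos m⟩, 0))
    rw [h1, Prod.mk.injEq, Fin.ext_iff] at h2
    rw [metacyclicParam, sum_orbitSize_mul_metacyclicChar hk hl hI j.2]
    refine if_congr ?_ rfl rfl
    simpa [metacyclicParam] using h2.symm
  have h0 : ∑ a ∈ I, ∑ α ∈ Finset.range (stabSize k m a), (orbitSize k a : ℂ) *
      ∑ g, θ.1 g * (metacyclicChar hk hl a α).1 g⁻¹ = 0 :=
    Finset.sum_eq_zero fun a ha => Finset.sum_eq_zero fun α hα => by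
      rw [sum_irrChar_mul_inv_eq_zero (hθ a ha α (Finset.mem_range.1 hα)).symm, mul_zero]
  have h3 : ∑ a ∈ I, ∑ α ∈ Finset.range (stabSize k m a), (orbitSize k a : ℂ) *
      ∑ g, θ.1 g * (metacyclicChar hk hl a α).1 g⁻¹ =
      ∑ g, θ.1 g * if g⁻¹ = 1 then (m : ℂ) * n else 0 := by
    simp_rw [← hreg, Finset.mul_sum]
    symm
    rw [Finset.sum_comm]
    refine Finset.sum_congr rfl fun a _ => ?_
    rw [Finset.sum_comm]
    exact Finset.sum_congr rfl fun α _ => Finset.sum_congr rfl fun g _ => by ring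
  rw [h3] at h0
  simp [irrChar_apply_one_ne_zero, NeZero.ne] at h0

/-- The inner product formula is reused with `χ_{0,0}`, the trivial character, as second factor.
Nonvanishing puts `c` in the orbit of `a`, and since `s_0 = m` the modulus is `s_a`, which gives `α
≡ γ mod s_a`. -/
theorem metacyclicChar_injOn (hk : (k : ZMod n) ^ m = 1) (hl : (l : ZMod n) * k = l)
    {I : Finset (ZMod n)} (hI : IsOrbitRepresentatives k I) {a c : ZMod n} {α γ : ℕ}
    (ha : a ∈ I) (hα : α < stabSize k m a) (hc : c ∈ I) (hγ : γ < stabSize k m c)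
    (h : metacyclicChar hk hl a α = metacyclicChar hk hl c γ) : a = c ∧ α = γ := by
  classical
  have h1 := charInner_metacyclicChar hk hl hI a 0 c α 0 γ
  rw [← h, charInner_metacyclicChar hk hl hI a 0 a α 0 α, if_pos ⟨0, by simp [fracPart_zero]⟩] at h1
  have hS : orbitSumCount k a 0 a ≠ 0 := by
    refine (Finset.card_pos.2 ⟨(a, 0), ?_⟩).ne'
    simp [self_mem_orbitFinset]
  have h0 : (Nat.gcd (stabSize k m a) (stabSize k m (0 : ZMod n)) *
      (orbitSize k a * orbitSumCount k a 0 a) : ℂ) ≠ 0 := by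
    refine mul_ne_zero ?_ (mul_ne_zero ?_ ?_)
    · exact Nat.cast_ne_zero.2 (Nat.gcd_pos_of_pos_left _ (stabSize_pos hk a)).ne'
    · exact Nat.cast_ne_zero.2 (orbitSize_pos a).ne'
    · exact Nat.cast_ne_zero.2 hS
  rw [h1] at h0
  obtain ⟨hcond, h0⟩ := ite_ne_right_iff.1 h0
  have hS' : orbitSumCount k a 0 c ≠ 0 := fun h => h0 (by simp [h])
  obtain ⟨r, hr, s, hs, hrs⟩ := exists_mem_of_orbitSumCount_ne_zero hS'
  rw [orbitFinset_zero, Finset.mem_singleton] at hs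
  rw [hs, add_zero] at hrs
  rw [hrs] at hr
  obtain rfl : c = a := eq_of_mem_orbitFinset hI hc ha hr
  refine ⟨rfl, ?_⟩
  obtain ⟨t, ht⟩ := hcond
  rw [stabSize_zero, Nat.gcd_eq_left (Dvd.intro_left _ (orbitSize_mul_stabSize hk c)),
    fracPart_zero] at ht
  have ht' : (α : ℤ) - γ = t * stabSize k m c := by
    have : (α : ℚ) - γ = t * stabSize k m c := by rw [← ht]; push_cast; ring
    exact_mod_cast this
  have := Int.eq_zero_of_abs_lt_dvd (Dvd.intro_left _ ht'.symm) (abs_lt.2 ⟨by omega, by omega⟩)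
  omega

theorem metacyclicChar_eq_of_mem (hk : (k : ZMod n) ^ m = 1) (hl : (l : ZMod n) * k = l)
    {a b : ZMod n} (h : b ∈ orbitFinset k a) (α : ℕ) :
    metacyclicChar hk hl b α = metacyclicChar hk hl a α := by
  refine Subtype.ext (funext fun g => ?_)
  obtain ⟨j, i, rfl⟩ := exists_eq_metacyclicElt g
  rw [metacyclicChar_apply, metacyclicChar_apply, orbitSize_eq_of_mem hk h,
    orbitFinset_eq_of_mem hk h, phase, phase, fracPart_eq_of_mem hl h]

open Classical in
/-- The multiplicity of the elements of `S_{c,γ}` in `S_{a,α} ⬝ S_{b,β}`. -/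
noncomputable def metacyclicMultiplicity (k l : ℤ) (m : ℕ) (a : ZMod n) (α : ℕ) (b : ZMod n)
    (β : ℕ) (c : ZMod n) (γ : ℕ) : ℕ :=
  if GammaCond k l m a b c α β γ then
    Nat.gcd (orbitSize k a) (orbitSize k b) * orbitSumCount k a b c else 0

theorem charWeight_metacyclicChar (hk : (k : ZMod n) ^ m = 1) (hl : (l : ZMod n) * k = l)
    (a : ZMod n) (α : ℕ) :
    charWeight _ (metacyclicChar hk hl a α) = ((orbitSize k a ^ 2 : ℕ) : ℂ) := by
  rw [charWeight, metacyclicChar_one, Nat.cast_pow]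

/-- The arithmetic is `r_a r_b gcd(s_a, s_b) = gcd(r_a, r_b) m`. The factor `r_c²` is split off
because it is the fibre size, leaving the multiplicity of a single element. -/
theorem charMult_metacyclicChar (hk : (k : ZMod n) ^ m = 1) (hl : (l : ZMod n) * k = l)
    {I : Finset (ZMod n)} (hI : IsOrbitRepresentatives k I) (a b c : ZMod n) (α β γ : ℕ) :
    charMult _ (metacyclicChar hk hl a α) (metacyclicChar hk hl b β) (metacyclicChar hk hl c γ) =
      ((orbitSize k c ^ 2 * metacyclicMultiplicity k l m a α b β c γ : ℕ) : ℂ) := by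
  classical
  have hm : (m : ℂ) ≠ 0 := NeZero.ne _
  have h1 : (orbitSize k a * orbitSize k b : ℂ) * (stabSize k m a).gcd (stabSize k m b) =
      (orbitSize k a).gcd (orbitSize k b) * m := by
    have h2 := Nat.lcm_mul_gcd_of_mul_eq (stabSize_pos hk a)
      ((orbitSize_mul_stabSize hk a).trans (orbitSize_mul_stabSize hk b).symm)
    rw [orbitSize_mul_stabSize hk] at h2
    have h3 := Nat.gcd_mul_lcm (orbitSize k a) (orbitSize k b)
    rw [← @Nat.cast_inj ℂ] at h2 h3
    push_cast at h2 h3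
    linear_combination (orbitSize k a).gcd (orbitSize k b) * h2 -
      (stabSize k m a).gcd (stabSize k m b) * h3
  refine mul_left_cancel₀ hm ?_
  rw [charMult, mul_left_comm, charInner_metacyclicChar hk hl hI, metacyclicChar_one,
    metacyclicChar_one, metacyclicChar_one, metacyclicMultiplicity]
  split_ifs
  · push_cast
    linear_combination (orbitSize k c ^ 2 * orbitSumCount k a b c : ℂ) * h1
  · simp

end Completeness

/-! ### Balanced covers as families of subsets with prescribed multiplicities -/

section Covers

open Classical in
theorem mulMultiplicity_eq_card {Q : Type*} [Mul Q] [Fintype Q] (S T : Set Q) (q : Q) :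
    mulMultiplicity S T q = (Finset.univ.filter fun p : Q × Q =>
      p.1 ∈ S ∧ p.2 ∈ T ∧ p.1 * p.2 = q).card := by
  rw [mulMultiplicity, Set.ncard_eq_toFinset_card']
  congr 1
  ext p
  simp

open Classical in
theorem ncard_mul_mem_eq_sum {Q X : Type*} [Mul Q] [Fintype Q] (f : Q → X) (x y z : X) :
    {p : Q × Q | f p.1 = x ∧ f p.2 = y ∧ f (p.1 * p.2) = z}.ncard =
      ∑ q ∈ Finset.univ.filter fun q => f q = z,
        mulMultiplicity (f ⁻¹' {x}) (f ⁻¹' {y}) q := by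
  simp_rw [mulMultiplicity_eq_card]
  rw [Set.ncard_eq_toFinset_card', Finset.card_eq_sum_card_fiberwise (f := fun p => p.1 * p.2)
    (t := Finset.univ.filter fun q => f q = z)]
  · refine Finset.sum_congr rfl fun q hq => ?_
    congr 1
    ext p
    simp only [Finset.mem_filter, Set.mem_toFinset, Set.mem_ofPred_eq, Finset.mem_univ, true_and,
      Set.mem_preimage, Set.mem_singleton_iff]
    have := (Finset.mem_filter.1 hq).2
    constructor
    · rintro ⟨⟨h1, h2, -⟩, h3⟩
      exact ⟨h1, h2, h3⟩
    · rintro ⟨h1, h2, h3⟩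
      exact ⟨⟨h1, h2, h3 ▸ this⟩, h3⟩
  · intro p hp
    simpa using (Set.mem_toFinset.1 hp).2.2

/-- On the fibre over `z` the multiplicity is constant by balance, and its sum over the `w z`
elements is `w z * N x y z`. In the converse, surjectivity comes from the positive weights. -/
theorem isCovering_and_isBalanced_iff {Q X : Type*} [Mul Q] [Finite Q] {w : X → ℕ}
    {N : X → X → X → ℕ} {w' : X → ℂ} {α : X → X → X → ℂ} (hw : ∀ x, w' x = w x)
    (hα : ∀ x y z, α x y z = ((w z * N x y z : ℕ) : ℂ)) (hpos : ∀ x, 0 < w x) (f : Q → X) :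
    IsCovering w' α f ∧ IsBalanced f ↔ (∀ x, (f ⁻¹' {x}).ncard = w x) ∧
      ∀ x y q, mulMultiplicity (f ⁻¹' {x}) (f ⁻¹' {y}) q = N x y (f q) := by
  classical
  cases nonempty_fintype Q
  have hcard : ∀ x, (f ⁻¹' {x}).ncard = (Finset.univ.filter fun q => f q = x).card := by
    intro x
    rw [Set.ncard_eq_toFinset_card']
    congr 1
    ext q
    simp
  constructor
  · rintro ⟨⟨-, h1, h2⟩, h3⟩
    have h1' : ∀ x, (f ⁻¹' {x}).ncard = w x := fun x => by
      have := h1 x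
      rw [hw] at this
      exact_mod_cast this.symm
    refine ⟨h1', fun x y q => ?_⟩
    have h4 := h2 x y (f q)
    have h5 : ∀ q' ∈ Finset.univ.filter (fun q' => f q' = f q),
        mulMultiplicity (f ⁻¹' {x}) (f ⁻¹' {y}) q' = mulMultiplicity (f ⁻¹' {x}) (f ⁻¹' {y}) q :=
      fun q' hq' => h3 x y (f q) q' (Finset.mem_filter.1 hq').2 q rfl
    rw [hα, ncard_mul_mem_eq_sum, Nat.cast_inj, Finset.sum_congr rfl h5, Finset.sum_const, smul_eq_mul, ← hcard,
      h1'] at h4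
    exact (Nat.eq_of_mul_eq_mul_left (hpos _) h4).symm
  · rintro ⟨h1, h2⟩
    refine ⟨⟨fun x => ?_, fun x => by rw [hw, h1], fun x y z => ?_⟩, ?_⟩
    · obtain ⟨q, hq⟩ := Set.nonempty_of_ncard_ne_zero (h1 x ▸ (hpos x).ne')
      exact ⟨q, hq⟩
    · rw [hα, ncard_mul_mem_eq_sum, Nat.cast_inj, Finset.sum_congr rfl fun q' hq' =>
        (h2 x y q').trans (by rw [(Finset.mem_filter.1 hq').2]), Finset.sum_const, smul_eq_mul,
        ← hcard, h1]
    · rintro x y z q rfl q' hq'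
      rw [h2, h2, hq']

variable {n m : ℕ} [NeZero n] [NeZero m] {k l : ℤ} {Q : Type*} [Mul Q]

/-- The multiplicities in the products of the sets `S_{a,α}` are those of a balanced cover. -/
def HasMetacyclicMultiplicities (k l : ℤ) (m : ℕ) (I : Finset (ZMod n))
    (S : ZMod n → ℕ → Finset Q) : Prop :=
  ∀ a ∈ I, ∀ α < stabSize k m a, ∀ b ∈ I, ∀ β < stabSize k m b, ∀ c ∈ I, ∀ γ < stabSize k m c,
    ∀ q ∈ S c γ, mulMultiplicity (S a α : Set Q) (S b β) q =
      metacyclicMultiplicity k l m a α b β c γ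

omit [Mul Q] in
-- A count: the `s_a` sets belonging to `a` have `s_a r_a² = m r_a` elements together, and the orbit
-- sizes add up to `n`.
theorem IsDisjointFamily.exists_mem [Finite Q] (hk : (k : ZMod n) ^ m = 1) {I : Finset (ZMod n)}
    (hI : IsOrbitRepresentatives k I) (hcard : Nat.card Q = m * n) {S : ZMod n → ℕ → Finset Q}
    (hS : IsDisjointFamily k m I S) (q : Q) : ∃ a ∈ I, ∃ α < stabSize k m a, q ∈ S a α := by
  classical
  cases nonempty_fintype Q
  set J : Finset ((_ : ZMod n) × ℕ) := I.sigma fun a => Finset.range (stabSize k m a) with hJ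
  have hJmem : ∀ p : (_ : ZMod n) × ℕ, p ∈ J ↔ p.1 ∈ I ∧ p.2 < stabSize k m p.1 := by
    intro p; simp [hJ]
  have h1 : (J.biUnion fun p => S p.1 p.2).card = m * n := by
    rw [Finset.card_biUnion]
    · have h2 : ∀ p ∈ J, (S p.1 p.2).card = orbitSize k p.1 ^ 2 := fun p hp =>
        hS.1 _ ((hJmem p).1 hp).1 _ ((hJmem p).1 hp).2
      rw [Finset.sum_congr rfl h2, hJ, Finset.sum_sigma]
      have h3 : ∀ a ∈ I, ∑ _α ∈ Finset.range (stabSize k m a), orbitSize k a ^ 2 =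
          ∑ _b ∈ orbitFinset k a, m := by
        intro a _
        rw [Finset.sum_const, Finset.card_range, Finset.sum_const, smul_eq_mul, smul_eq_mul, pow_two,
          ← mul_assoc, mul_comm (stabSize k m a), orbitSize_mul_stabSize hk, mul_comm, orbitSize]
      rw [Finset.sum_congr rfl h3, sum_sum_orbitFinset hk hI]
      simp [mul_comm]
    · intro p hp p' hp' hne
      refine hS.2 _ ((hJmem p).1 hp).1 _ ((hJmem p).1 hp).2 _ ((hJmem p').1 hp').1 _
        ((hJmem p').1 hp').2 fun h => hne ?_
      rw [Prod.mk.injEq] at h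
      exact Sigma.ext h.1 (heq_of_eq h.2)
  have h2 : J.biUnion (fun p => S p.1 p.2) = Finset.univ := by
    rw [← Finset.card_eq_iff_eq_univ, h1, ← hcard, Nat.card_eq_fintype_card]
  have h3 := h2 ▸ Finset.mem_univ q
  obtain ⟨p, hp, hq⟩ := Finset.mem_biUnion.1 h3
  exact ⟨p.1, ((hJmem p).1 hp).1, p.2, ((hJmem p).1 hp).2, hq⟩

omit [Mul Q] [NeZero m] in
theorem IsDisjointFamily.eq_of_mem {I : Finset (ZMod n)} {S : ZMod n → ℕ → Finset Q}
    (hS : IsDisjointFamily k m I S) {a c : ZMod n} {α γ : ℕ} {q : Q} (ha : a ∈ I)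
    (hα : α < stabSize k m a) (hc : c ∈ I) (hγ : γ < stabSize k m c) (hq : q ∈ S a α)
    (hq' : q ∈ S c γ) : a = c ∧ α = γ := by
  by_contra h
  refine Finset.disjoint_left.1 (hS.2 a ha α hα c hc γ hγ fun h' => h ?_) hq hq'
  rwa [Prod.mk.injEq] at h'

theorem isBalancedCover_iff (hk : (k : ZMod n) ^ m = 1) (hl : (l : ZMod n) * k = l)
    {I : Finset (ZMod n)} (hI : IsOrbitRepresentatives k I) [Finite Q] :
    IsBalancedCover (MetacyclicGroup k l m n) Q ↔
      ∃ f : Q → irrChar (MetacyclicGroup k l m n),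
        (∀ a ∈ I, ∀ α < stabSize k m a,
          (f ⁻¹' {metacyclicChar hk hl a α}).ncard = orbitSize k a ^ 2) ∧
        ∀ a ∈ I, ∀ α < stabSize k m a, ∀ b ∈ I, ∀ β < stabSize k m b, ∀ c ∈ I,
          ∀ γ < stabSize k m c, ∀ q, f q = metacyclicChar hk hl c γ →
            mulMultiplicity (f ⁻¹' {metacyclicChar hk hl a α}) (f ⁻¹' {metacyclicChar hk hl b β}) q
              = metacyclicMultiplicity k l m a α b β c γ := by
  choose A hA B hB hAB using exists_metacyclicChar_eq hk hl hI
  have hA' : ∀ a ∈ I, ∀ α < stabSize k m a, A (metacyclicChar hk hl a α) = a ∧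
      B (metacyclicChar hk hl a α) = α := fun a ha α hα =>
    metacyclicChar_injOn hk hl hI (hA _) (hB _) ha hα (hAB _)
  refine exists_congr fun f => ?_
  rw [isCovering_and_isBalanced_iff (w := fun θ => orbitSize k (A θ) ^ 2)
    (N := fun θ φ ψ => metacyclicMultiplicity k l m (A θ) (B θ) (A φ) (B φ) (A ψ) (B ψ))]
  · refine and_congr ⟨fun h a ha α hα => ?_, fun h θ => ?_⟩ ⟨?_, fun h θ φ q => ?_⟩
    · rw [h, (hA' a ha α hα).1]
    · rw [← h _ (hA θ) _ (hB θ), hAB]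
    · intro h a ha α hα b hb β hβ c hc γ hγ q hq
      rw [h, hq, (hA' a ha α hα).1, (hA' a ha α hα).2, (hA' b hb β hβ).1, (hA' b hb β hβ).2,
        (hA' c hc γ hγ).1, (hA' c hc γ hγ).2]
    · rw [← h _ (hA θ) _ (hB θ) _ (hA φ) _ (hB φ) _ (hA (f q)) _ (hB (f q)) q (hAB _).symm, hAB,
        hAB]
  · intro θ
    conv_lhs => rw [← hAB θ]
    exact charWeight_metacyclicChar hk hl _ _
  · intro θ φ ψ
    conv_lhs => rw [← hAB θ, ← hAB φ, ← hAB ψ]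
    exact charMult_metacyclicChar hk hl hI _ _ _ _ _ _
  · exact fun θ => pow_pos (orbitSize_pos _) 2

theorem IsBalancedCover.exists_isDisjointFamily (hk : (k : ZMod n) ^ m = 1)
    (hl : (l : ZMod n) * k = l) {I : Finset (ZMod n)} (hI : IsOrbitRepresentatives k I) [Finite Q]
    (h : IsBalancedCover (MetacyclicGroup k l m n) Q) :
    ∃ S : ZMod n → ℕ → Finset Q, IsDisjointFamily k m I S ∧
      (∀ (c : ZMod n) (i γ : ℕ), S (c * (k : ZMod n) ^ i) γ = S c γ) ∧
      HasMetacyclicMultiplicities k l m I S := by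
  classical
  obtain ⟨f, h1, h2⟩ := (isBalancedCover_iff hk hl hI).1 h
  refine ⟨fun a α => (Set.toFinite (f ⁻¹' {metacyclicChar hk hl a α})).toFinset,
    ⟨fun a ha α hα => ?_, ?_⟩, ?_, ?_⟩
  · rw [← h1 a ha α hα, Set.ncard_eq_toFinset_card]
  · intro a ha α hα b hb β hβ hne
    refine Finset.disjoint_left.2 fun q hq hq' => hne ?_
    rw [Set.Finite.mem_toFinset, Set.mem_preimage, Set.mem_singleton_iff] at hq hq'
    rw [Prod.mk.injEq]
    exact metacyclicChar_injOn hk hl hI ha hα hb hβ (hq.symm.trans hq')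
  · intro c i γ
    simp only [metacyclicChar_eq_of_mem hk hl (mem_orbitFinset.2 ⟨i, rfl⟩) γ]
  · intro a ha α hα b hb β hβ c hc γ hγ q hq
    rw [Set.Finite.coe_toFinset, Set.Finite.coe_toFinset]
    exact h2 a ha α hα b hb β hβ c hc γ hγ q (by simpa using hq)

theorem IsDisjointFamily.isBalancedCover (hk : (k : ZMod n) ^ m = 1)
    (hl : (l : ZMod n) * k = l) {I : Finset (ZMod n)} (hI : IsOrbitRepresentatives k I) [Finite Q]
    (hcard : Nat.card Q = m * n) {S : ZMod n → ℕ → Finset Q} (hS : IsDisjointFamily k m I S)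
    (h : HasMetacyclicMultiplicities k l m I S) :
    IsBalancedCover (MetacyclicGroup k l m n) Q := by
  choose A hA B hB hAB using hS.exists_mem hk hI hcard
  have hfib : ∀ a ∈ I, ∀ α < stabSize k m a,
      (fun q => metacyclicChar hk hl (A q) (B q)) ⁻¹' {metacyclicChar hk hl a α} = S a α := by
    intro a ha α hα
    ext q
    rw [Set.mem_preimage, Set.mem_singleton_iff, Finset.mem_coe]
    constructor
    · intro hq
      obtain ⟨h1, h2⟩ := metacyclicChar_injOn hk hl hI (hA q) (hB q) ha hα hq
      exact h1 ▸ h2 ▸ hAB q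
    · intro hq
      obtain ⟨h1, h2⟩ := hS.eq_of_mem (hA q) (hB q) ha hα (hAB q) hq
      rw [h1, h2]
  refine (isBalancedCover_iff hk hl hI).2 ⟨fun q => metacyclicChar hk hl (A q) (B q),
    fun a ha α hα => ?_, fun a ha α hα b hb β hβ c hc γ hγ q hq => ?_⟩
  · rw [hfib a ha α hα, Set.ncard_coe_finset, hS.1 a ha α hα]
  · rw [hfib a ha α hα, hfib b hb β hβ]
    refine h a ha α hα b hb β hβ c hc γ hγ q ?_
    rw [← Finset.mem_coe, ← hfib c hc γ hγ]
    exact hq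

/-! ### Formal sums and the two product formulas -/

section Coefficients

variable {R : Type*} [Semiring R]

open Classical in
omit [Mul Q] in
theorem coeff_setSum (S : Finset Q) (q : Q) :
    (setSum R S).coeff q = if q ∈ S then 1 else 0 := by
  rw [setSum, MonoidAlgebra.coeff_sum, Finsupp.finsetSum_apply]
  simp [Finsupp.single_apply]

theorem coeff_setSum_mul_setSum [Finite Q] (S T : Finset Q) (q : Q) :
    (setSum R S * setSum R T).coeff q = (mulMultiplicity (S : Set Q) T q : R) := by
  classical
  cases nonempty_fintype Q
  rw [MonoidAlgebra.coeff_mul_antidiag (s := Finset.univ.filter fun p : Q × Q => p.1 * p.2 = q)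
    _ _ _ (by simp), mulMultiplicity_eq_card, Finset.card_filter, Finset.sum_filter, Nat.cast_sum]
  refine Finset.sum_congr rfl fun p _ => ?_
  rw [coeff_setSum, coeff_setSum]
  by_cases h1 : p.1 ∈ S <;> by_cases h2 : p.2 ∈ T <;> simp [h1, h2]

end Coefficients

/-- Coefficients are compared at each `q`. Exactly one `S_{c,γ}` contains `q`, so only one term on
the right survives. -/
theorem IsDisjointFamily.setSum_mul_setSum_nat_iff (hk : (k : ZMod n) ^ m = 1)
    {I : Finset (ZMod n)} (hI : IsOrbitRepresentatives k I) [Finite Q]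
    (hcard : Nat.card Q = m * n) {S : ZMod n → ℕ → Finset Q} (hS : IsDisjointFamily k m I S) :
    HasMetacyclicMultiplicities k l m I S ↔
      ∀ a ∈ I, ∀ α < stabSize k m a, ∀ b ∈ I, ∀ β < stabSize k m b,
        setSum ℕ (S a α) * setSum ℕ (S b β) =
          Nat.gcd (orbitSize k a) (orbitSize k b) •
            ∑ c ∈ I, ∑ γ ∈ gammaSet k l m a b c α β,
              orbitSumCount k a b c • setSum ℕ (S c γ) := by
  classical
  have hcoeff : ∀ a α b β, ∀ c ∈ I, ∀ γ < stabSize k m c, ∀ q ∈ S c γ,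
      (Nat.gcd (orbitSize k a) (orbitSize k b) • ∑ c ∈ I, ∑ γ ∈ gammaSet k l m a b c α β,
        orbitSumCount k a b c • setSum ℕ (S c γ)).coeff q =
        metacyclicMultiplicity k l m a α b β c γ := by
    intro a α b β c hc γ hγ q hq
    have h1 : ∀ c' ∈ I, ∀ γ' ∈ gammaSet k l m a b c' α β,
        (orbitSumCount k a b c' • setSum ℕ (S c' γ')).coeff q =
          if γ' = γ then (if c' = c then orbitSumCount k a b c else 0) else 0 := by
      intro c' hc' γ' hγ'
      have hγ'' := Finset.mem_range.1 (Finset.mem_filter.1 hγ').1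
      rw [MonoidAlgebra.coeff_smul_apply, coeff_setSum]
      by_cases h : q ∈ S c' γ'
      · obtain ⟨rfl, rfl⟩ := hS.eq_of_mem hc' hγ'' hc hγ h hq
        simp [h]
      · have : ¬ (γ' = γ ∧ c' = c) := by rintro ⟨rfl, rfl⟩; exact h hq
        simp only [h, if_false, smul_zero, ← ite_and, this]
    rw [MonoidAlgebra.coeff_smul_apply]
    simp only [MonoidAlgebra.coeff_sum, Finsupp.finsetSum_apply]
    rw [Finset.sum_congr rfl fun c' hc' => Finset.sum_congr rfl (h1 c' hc')]
    simp only [Finset.sum_ite_eq']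
    rw [Finset.sum_eq_single c]
    · simp [gammaSet, hγ, metacyclicMultiplicity]
    · intro c' _ hne
      simp [hne]
    · exact fun h => absurd hc h
  constructor
  · intro h a ha α hα b hb β hβ
    refine MonoidAlgebra.coeff_injective (Finsupp.ext fun q => ?_)
    obtain ⟨c, hc, γ, hγ, hq⟩ := hS.exists_mem hk hI hcard q
    rw [hcoeff a α b β c hc γ hγ q hq, coeff_setSum_mul_setSum,
      h a ha α hα b hb β hβ c hc γ hγ q hq, Nat.cast_id]
  · intro h a ha α hα b hb β hβ c hc γ hγ q hq
    rw [← hcoeff a α b β c hc γ hγ q hq, ← h a ha α hα b hb β hβ, coeff_setSum_mul_setSum,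
      Nat.cast_id]

theorem IsDisjointFamily.setSum_mul_setSum_rat_iff (hk : (k : ZMod n) ^ m = 1)
    (hl : (l : ZMod n) * k = l) {I : Finset (ZMod n)} (hI : IsOrbitRepresentatives k I) [Finite Q]
    (hcard : Nat.card Q = m * n) {S : ZMod n → ℕ → Finset Q} (hS : IsDisjointFamily k m I S)
    (hconv : ∀ (c : ZMod n) (i γ : ℕ), S (c * (k : ZMod n) ^ i) γ = S c γ) :
    HasMetacyclicMultiplicities k l m I S ↔
      ∀ a ∈ I, ∀ α < stabSize k m a, ∀ b ∈ I, ∀ β < stabSize k m b,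
        setSum ℚ (S a α) * setSum ℚ (S b β) =
          ((orbitSize k a * Nat.gcd (orbitSize k a) (orbitSize k b) : ℕ) : ℚ) •
            ∑ i ∈ Finset.range (orbitSize k b),
              ∑ γ ∈ gammaSet k l m a b (a + b * (k : ZMod n) ^ i) α β,
                (orbitSize k (a + b * (k : ZMod n) ^ i) : ℚ)⁻¹ •
                  setSum ℚ (S (a + b * (k : ZMod n) ^ i) γ) := by
  classical
  have hcoeff : ∀ a α b β, ∀ c ∈ I, ∀ γ < stabSize k m c, ∀ q ∈ S c γ,
      (((orbitSize k a * Nat.gcd (orbitSize k a) (orbitSize k b) : ℕ) : ℚ) •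
        ∑ i ∈ Finset.range (orbitSize k b),
          ∑ γ ∈ gammaSet k l m a b (a + b * (k : ZMod n) ^ i) α β,
            (orbitSize k (a + b * (k : ZMod n) ^ i) : ℚ)⁻¹ •
              setSum ℚ (S (a + b * (k : ZMod n) ^ i) γ)).coeff q =
        metacyclicMultiplicity k l m a α b β c γ := by
    intro a α b β c hc γ hγ q hq
    -- Here `d` stands for `a + b k^i`, which need not lie in `I`; `hconv` replaces it by its
    -- representative, so it contributes `1/r_c` or `0`.
    have h1 : ∀ d : ZMod n, ∑ γ' ∈ gammaSet k l m a b d α β,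
        ((orbitSize k d : ℚ)⁻¹ • setSum ℚ (S d γ')).coeff q =
          (if GammaCond k l m a b c α β γ then (orbitSize k c : ℚ)⁻¹ else 0) *
            ((if d ∈ orbitFinset k c then 1 else 0 : ℕ) : ℚ) := by
      intro d
      obtain ⟨c', ⟨hc', hd⟩, -⟩ := hI d
      have hd' := mem_orbitFinset_symm hk hd
      have hSd : ∀ γ', S d γ' = S c' γ' := by
        obtain ⟨i, rfl⟩ := mem_orbitFinset.1 hd'
        exact fun γ' => hconv c' i γ'
      have h2 : ∀ γ' ∈ gammaSet k l m a b d α β,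
          ((orbitSize k d : ℚ)⁻¹ • setSum ℚ (S d γ')).coeff q =
            if γ' = γ then (if c' = c then (orbitSize k c : ℚ)⁻¹ else 0) else 0 := by
        intro γ' hγ'
        have hγ'' := Finset.mem_range.1 (Finset.mem_filter.1 hγ').1
        rw [stabSize_eq_of_mem hk hd'] at hγ''
        rw [MonoidAlgebra.coeff_smul_apply, coeff_setSum, hSd, orbitSize_eq_of_mem hk hd']
        by_cases h : q ∈ S c' γ'
        · obtain ⟨rfl, rfl⟩ := hS.eq_of_mem hc' hγ'' hc hγ h hq
          simp [h]
        · have : ¬ (γ' = γ ∧ c' = c) := by rintro ⟨rfl, rfl⟩; exact h hq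
          simp only [h, if_false, smul_zero, ← ite_and, this]
      have h3 : d ∈ orbitFinset k c ↔ c' = c := by
        refine ⟨fun h => eq_of_mem_orbitFinset hI hc' hc ?_, fun h => h ▸ hd'⟩
        rw [← orbitFinset_eq_of_mem hk h]
        exact hd
      rw [Finset.sum_congr rfl h2, Finset.sum_ite_eq', gammaSet_congr hk hl hd']
      by_cases h : c' = c
      · subst h
        simp [gammaSet, hγ, h3]
      · simp [h, h3]
    have h4 : (orbitSize k a : ℚ) * ∑ i ∈ Finset.range (orbitSize k b),
        ((if a + b * (k : ZMod n) ^ i ∈ orbitFinset k c then 1 else 0 : ℕ) : ℚ) =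
          orbitSize k c * orbitSumCount k a b c := by
      exact_mod_cast orbitSize_mul_sum_range_ite hk a b c
    have h5 : (orbitSize k c : ℚ) ≠ 0 := Nat.cast_ne_zero.2 (orbitSize_pos c).ne'
    rw [MonoidAlgebra.coeff_smul_apply]
    simp only [MonoidAlgebra.coeff_sum, Finsupp.finsetSum_apply]
    rw [Finset.sum_congr rfl fun i _ => h1 _, ← Finset.mul_sum, metacyclicMultiplicity]
    split_ifs
    · rw [smul_eq_mul]
      push_cast at h4 ⊢
      field_simp
      linear_combination ((orbitSize k a).gcd (orbitSize k b) : ℚ) * h4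
    · simp
  constructor
  · intro h a ha α hα b hb β hβ
    refine MonoidAlgebra.coeff_injective (Finsupp.ext fun q => ?_)
    obtain ⟨c, hc, γ, hγ, hq⟩ := hS.exists_mem hk hI hcard q
    rw [hcoeff a α b β c hc γ hγ q hq, coeff_setSum_mul_setSum,
      h a ha α hα b hb β hβ c hc γ hγ q hq]
  · intro h a ha α hα b hb β hβ c hc γ hγ q hq
    rw [← @Nat.cast_inj ℚ, ← hcoeff a α b β c hc γ hγ q hq, ← h a ha α hα b hb β hβ,
      coeff_setSum_mul_setSum]

end Covers

/-! ### The two criteria -/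

theorem mainTheorem1 (k l : ℤ) (m n : ℕ) [NeZero m] [NeZero n]
    (hk : IsCoprime (n : ℤ) k) (hkm : k ^ m ≡ 1 [ZMOD n]) (hl : l * (k - 1) ≡ 0 [ZMOD n])
    (I : Finset (ZMod n)) (hI : IsOrbitRepresentatives k I)
    {Q : Type*} [Mul Q] (hQ : IsQuasigroup Q) (hcard : Nat.card Q = m * n) :
    (IsBalancedCover (MetacyclicGroup k l m n) Q ↔
      ∃ S : ZMod n → ℕ → Finset Q, IsDisjointFamily k m I S ∧
        ∀ a ∈ I, ∀ α < stabSize k m a, ∀ b ∈ I, ∀ β < stabSize k m b,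
          setSum ℕ (S a α) * setSum ℕ (S b β) =
            Nat.gcd (orbitSize k a) (orbitSize k b) •
              ∑ c ∈ I, ∑ γ ∈ gammaSet k l m a b c α β,
                orbitSumCount k a b c • setSum ℕ (S c γ)) ∧
    (IsBalancedCover (MetacyclicGroup k l m n) Q ↔
      ∃ S : ZMod n → ℕ → Finset Q, IsDisjointFamily k m I S ∧
        -- the convention that `S_{c,γ}` depends only on the orbit of `c`
        (∀ (c : ZMod n) (i γ : ℕ), S (c * (k : ZMod n) ^ i) γ = S c γ) ∧
        ∀ a ∈ I, ∀ α < stabSize k m a, ∀ b ∈ I, ∀ β < stabSize k m b,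
          setSum ℚ (S a α) * setSum ℚ (S b β) =
            ((orbitSize k a * Nat.gcd (orbitSize k a) (orbitSize k b) : ℕ) : ℚ) •
              ∑ i ∈ Finset.range (orbitSize k b),
                ∑ γ ∈ gammaSet k l m a b (a + b * (k : ZMod n) ^ i) α β,
                  (orbitSize k (a + b * (k : ZMod n) ^ i) : ℚ)⁻¹ •
                    setSum ℚ (S (a + b * (k : ZMod n) ^ i) γ)) := by
  have hk' : (k : ZMod n) ^ m = 1 := by
    have := (ZMod.intCast_eq_intCast_iff _ _ n).2 hkm
    simpa using this
  have hl' : (l : ZMod n) * k = l := by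
    have := (ZMod.intCast_eq_intCast_iff _ _ n).2 hl
    rw [mul_sub, mul_one] at this
    push_cast at this
    exact sub_eq_zero.1 this
  -- `Nat.card` is `0` on infinite types, so a nonzero order implies finiteness.
  have : Finite Q := Nat.finite_of_card_ne_zero
    (hcard ▸ mul_ne_zero (NeZero.ne m) (NeZero.ne n))
  refine ⟨⟨fun h => ?_, fun ⟨S, hS, h⟩ => ?_⟩, ⟨fun h => ?_, fun ⟨S, hS, hconv, h⟩ => ?_⟩⟩
  · obtain ⟨S, hS, -, hmul⟩ := h.exists_isDisjointFamily hk' hl' hI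
    exact ⟨S, hS, (hS.setSum_mul_setSum_nat_iff hk' hI hcard).1 hmul⟩
  · exact hS.isBalancedCover hk' hl' hI hcard ((hS.setSum_mul_setSum_nat_iff hk' hI hcard).2 h)
  · obtain ⟨S, hS, hconv, hmul⟩ := h.exists_isDisjointFamily hk' hl' hI
    exact ⟨S, hS, hconv, (hS.setSum_mul_setSum_rat_iff hk' hl' hI hcard hconv).1 hmul⟩
  · exact hS.isBalancedCover hk' hl' hI hcard
      ((hS.setSum_mul_setSum_rat_iff hk' hl' hI hcard hconv).2 h)
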